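/- Let $T:[0,1)\to[0,1)$ be a right-continuous interval exchange transformation: a bijection for which there are $N\ge 1$, numbers $0=a_0<a_1<\dots<a_N=1$ and $\sigma_1,\dots,\sigma_N\in\mathbb R$ such that $Tx=x+\sigma_i$ for all $x\in[a_{i-1},a_i)$, $1\le i\le N$. Let $\mathcal A_f\subset(0,1)$ be a finite set and let $f:[0,1)\setminus\mathcal A_f\to[0,\infty)$ be a roof function that is not identically zero on $(0,1)\setminus\mathcal A_f$, is $C^2$ on $(0,1)\setminus\mathcal A_f$, and satisfies $$\lim_{y\to x^-}f(y)=\lim_{y\to x^+}f(y)=\infty\qquad\text{for every }x\in\mathcal A_f .$$ Assume that (i) every discontinuity of $T$ belongs to $\mathcal A_f$; (ii) $f$ is of at least logarithmic growth: there are $B,C>0$ such that $$f''(x)\ \ge\ \frac{C}{\min_{y\in\mathcal A_f}|x-y|^2}-B\qquad\text{for every }x\in(0,1)\setminus\mathcal A_f$$ (if $\mathcal A_f=\emptyset$, the first term on the right is read as $0$). Let $T^f=(T^f_t)_{t\in\mathbb R}$ be the special flow over $T$ under $f$. It acts on $X=\{(x,u): x\in[0,1)\setminus\mathcal A_f,\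 0\le u<f(x)\}$ with two-dimensional Lebesgue measure $\mu$, and it is defined almost everywhere by $$T^f_t(x,u)=\bigl(T^nx,\ u+t-S_n(x)\bigr),\qquad n\in\mathbb Z,\quad S_n(x)\le u+t<S_{n+1}(x),$$ where $S_n(x)=\sum_{k=0}^{n-1}f(T^kx)$ for $n\ge0$ and $S_n(x)=-\sum_{k=n}^{-1}f(T^kx)$ for $n<0$. Then $T^f$ is weakly mixing if and only if $T$ is ergodic with respect to Lebesgue measure. Here the flow $T^f$ is called weakly mixing if, for every $s\in\mathbb R$, every measurable $g:X\to\mathbb C$ such that for each $t\in\mathbb R$ one has $g\circ T^f_t=e^{2\pi i st}g$ $\mu$-almost everywhere is $\mu$-almost everywhere equal to a constant. -/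

import Mathlib

open Set Filter Topology MeasureTheory

/-- The half-open unit interval `[0,1)`, with the topology and Borel structure of a subspace
of `ℝ`. -/
abbrev UnitIco : Type := ↥(Set.Ico (0 : ℝ) 1)

/-- Lebesgue measure on `[0,1)`. -/
noncomputable def lebesgueIco : Measure UnitIco :=
  Measure.comap Subtype.val (volume : Measure ℝ)

/-- A bijection `T` of `[0,1)` is a (right-continuous) interval exchange transformation: there are
`0 = a₀ < a₁ < ⋯ < a_N = 1` and `σ₁, …, σ_N` with `T x = x + σᵢ` on `[aᵢ₋₁, aᵢ)`. -/
def IsIET (T : Equiv.Perm UnitIco) : Prop :=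
  ∃ (N : ℕ) (a : Fin (N + 1) → ℝ) (σ : Fin N → ℝ),
    1 ≤ N ∧ StrictMono a ∧ a 0 = 0 ∧ a (Fin.last N) = 1 ∧
      ∀ (i : Fin N) (x : UnitIco), a i.castSucc ≤ (x : ℝ) → (x : ℝ) < a i.succ →
        (T x : ℝ) = (x : ℝ) + σ i

/-- At least logarithmic growth of `f` with respect to the singular set `A`. For nonempty finite
`A`, `Metric.infDist x A` is the minimum of `|x - y|` over `y ∈ A`. -/
def AtLeastLogGrowth (f : ℝ → ℝ) (A : Set ℝ) : Prop :=
  ∃ B C : ℝ, 0 < B ∧ 0 < C ∧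
    ∀ x ∈ Set.Ioo (0 : ℝ) 1 \ A, C / (Metric.infDist x A) ^ 2 - B ≤ deriv (deriv f) x

/-- The Birkhoff sums of `f` along `T`, for all `n : ℤ`: `f x + ⋯ + f (T ^ (n - 1) x)` for
`n ≥ 0`, and `-(f (T⁻¹ x) + ⋯ + f (T ^ n x))` for `n < 0`. -/
noncomputable def cocycleSum (T : Equiv.Perm UnitIco) (f : ℝ → ℝ) (n : ℤ) (x : UnitIco) : ℝ :=
  ∑ k ∈ Finset.Ico (0 : ℤ) n, f ((T ^ k) x) - ∑ k ∈ Finset.Ico n (0 : ℤ), f ((T ^ k) x)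

/-- The one-step rule for Birkhoff sums, valid for positive and negative `n`. -/
theorem cocycleSum_add_one (T : Equiv.Perm UnitIco) (f : ℝ → ℝ) (n : ℤ) (x : UnitIco) :
    cocycleSum T f (n + 1) x = cocycleSum T f n x + f ((T ^ n) x) := by
  unfold cocycleSum
  rcases le_or_gt 0 n with hn | hn
  · have h : Finset.Ico (0 : ℤ) (n + 1) = insert n (Finset.Ico 0 n) := by
      ext k; simp only [Finset.mem_Ico, Finset.mem_insert]; lia
    rw [Finset.Ico_eq_empty_of_le (show (0 : ℤ) ≤ n + 1 by lia), Finset.Ico_eq_empty_of_le hn, h,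
      Finset.sum_insert (by simp)]
    ring
  · have h : Finset.Ico n (0 : ℤ) = insert n (Finset.Ico (n + 1) 0) := by
      ext k; simp only [Finset.mem_Ico, Finset.mem_insert]; lia
    rw [Finset.Ico_eq_empty_of_le (show n + 1 ≤ (0 : ℤ) by lia), Finset.Ico_eq_empty_of_le hn.le, h,
      Finset.sum_insert (by simp)]
    ring

/-- The phase space `{(x, u) : x ∈ [0,1), 0 ≤ u < f x}` of the special flow. -/
abbrev SpecialFlowSpace (f : ℝ → ℝ) : Type :=
  ↥{p : UnitIco × ℝ | 0 ≤ p.2 ∧ p.2 < f p.1}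

/-- The restriction of two-dimensional Lebesgue measure to the phase space. -/
noncomputable def specialFlowMeasure (f : ℝ → ℝ) : Measure (SpecialFlowSpace f) :=
  Measure.comap Subtype.val (lebesgueIco.prod (volume : Measure ℝ))

open Classical in
/-- The special flow over `T` under the roof `f`. At time `t` it sends `(x, u)` to
`(T ^ n x, u + t - S_n x)`, where `S_n` is the `n`-th Birkhoff sum of `f` and `n : ℤ` is the index
with `S_n x ≤ u + t < S_{n+1} x`. (If the orbit of `x` is such that no such `n` exists, the point
is left where it is; under the hypotheses of the theorem this happens on a null set only, and
`n` is unique almost everywhere.) -/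
noncomputable def specialFlow (T : Equiv.Perm UnitIco) (f : ℝ → ℝ) (t : ℝ)
    (z : SpecialFlowSpace f) : SpecialFlowSpace f :=
  if h : ∃ n : ℤ, cocycleSum T f n z.1.1 ≤ z.1.2 + t ∧
      z.1.2 + t < cocycleSum T f (n + 1) z.1.1 then
    ⟨((T ^ h.choose) z.1.1, z.1.2 + t - cocycleSum T f h.choose z.1.1), by
      have h1 := h.choose_spec.1
      have h2 := h.choose_spec.2
      rw [cocycleSum_add_one] at h2
      exact ⟨by simpa using h1, by simp only; linarith⟩⟩
  else z

/-- Weak mixing of a measure-preserving flow `φ` of `(X, μ)`: every measurable eigenfunction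
(for an arbitrary frequency `s`, including `s = 0`) is constant almost everywhere. -/
def IsWeaklyMixingFlow {X : Type*} [MeasurableSpace X] (φ : ℝ → X → X) (μ : Measure X) : Prop :=
  ∀ (s : ℝ) (g : X → ℂ), Measurable g →
    (∀ t : ℝ, ∀ᵐ x ∂μ, g (φ t x) = Complex.exp (2 * Real.pi * Complex.I * s * t) * g x) →
    ∃ c : ℂ, ∀ᵐ x ∂μ, g x = c

/-! Ergodicity implies weak mixing. By Fubini, a measurable eigenfunction is $e^{i\theta u}h(x)$
with $h(Tx)=e^{i\theta f(x)}h(x)$ (`exists_base_function`). Ergodicity makes $|h|$ constant, and $h$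
itself constant when $\theta=0$. If $\theta\ne0$ and $h\ne0$, the powers of $h/|h|$ solve the
equation with frequencies $k\theta$, so it suffices to exclude large frequencies
(`no_transfer_function`).

Suppose that the orbit of $y$ up to time $m$ comes within $4/m$ of a singularity, yet stays farther
than $R\approx 4\eta/m$ from all of them, with $\eta$ small and fixed. On the ball of radius $R$
about $y$ the iterates are translations, and the Birkhoff sum $F$ satisfies $F''\ge cm^2$: the close
visit contributes order $m^2$, while all the other terms together cost only $O(m)$. By van der
Corput, the mean of $e^{i\theta F}$ over some subinterval of length $R/4$ is $O(1/|\theta|)$. By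
Lebesgue density $h$ is nearly constant around both $y$ and $T^{m+1}y$, so integrating $h\circ
T^{m+1}=e^{i\theta F}h$ contradicts $|h|=1$ once $|\theta|$ is large.

Such $y$ exist by a property of every ergodic interval exchange (`exists_frequent_hits`): for
arbitrarily large $m$, a set of measure at least a fixed $\rho$ hits the $4/m$-neighbourhoods of the
singularities by time $m$. A bounded number of hitting sets covers $[0,1)$. Points in short
continuity intervals of $T^n$ are hit at scale $n$; for the others the scale is a first return time
$p$, which depends only on a cut point, and continuity intervals up to time $p$ have length at most
$4/p$ (`TranslatesOn.mul_length_le`). A longer one would contain a two-interval exchange trapping an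
orbit away from $0$.

Weak mixing implies ergodicity. A $T$-invariant set lifts to a flow-invariant function, hence is
trivial relative to $\{f>0\}$. As $f$ may vanish on intervals, it remains to see that almost every
orbit meets $\{f>0\}$ (`IsWeaklyMixingFlow.ae_orbit_meets_support`). An orbit that does not is
bounded away from the singularities, hence periodic together with a ball around it; if no such ball
met orbits through $\{f>0\}$ in positive measure, connectedness of $[0,1)$ would make $f$ vanish
almost everywhere. Otherwise a small periodic set is invariant and nontrivial on $\{f>0\}$. -/

/-! ### Interval exchanges: piecewise translations and invariance of Lebesgue measure -/

/-- An interval exchange splits `[0,1)` into finitely many pieces `X i` on which it is the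
translation by `σ i`, with images `Y i`. -/
theorem IsIET.exists_pieces {T : Equiv.Perm UnitIco} (hT : IsIET T) :
    ∃ (N : ℕ) (X Y : Fin N → Set UnitIco) (σ : Fin N → ℝ),
      (∀ i, MeasurableSet (X i)) ∧ (∀ i, MeasurableSet (Y i)) ∧ Pairwise (Function.onFun Disjoint X) ∧
      (⋃ i, X i) = univ ∧ (∀ i, ∀ x ∈ X i, (T x : ℝ) = x + σ i) ∧
      (∀ i x, T x ∈ Y i ↔ x ∈ X i) ∧
      (∀ i, ∀ x ∈ X i, ∃ ε > 0, ∀ y : UnitIco, (x : ℝ) ≤ y → (y : ℝ) < x + ε → y ∈ X i) := by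
  obtain ⟨N, a, σ, -, ha, h0, h1, h⟩ := hT
  refine ⟨N, fun i => {x | a i.castSucc ≤ (x : ℝ) ∧ (x : ℝ) < a i.succ},
    fun i => {y | a i.castSucc ≤ (y : ℝ) - σ i ∧ (y : ℝ) - σ i < a i.succ}, σ, ?_, ?_, ?_, ?_, ?_,
    ?_, ?_⟩
  · intro i
    exact (measurableSet_le measurable_const measurable_subtype_coe).inter
      (measurableSet_lt measurable_subtype_coe measurable_const)
  · intro i
    exact (measurableSet_le measurable_const (measurable_subtype_coe.sub_const _)).inter
      (measurableSet_lt (measurable_subtype_coe.sub_const _) measurable_const)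
  · have key : ∀ i j : Fin N, i < j → ∀ x : UnitIco, (x : ℝ) < a i.succ →
        a j.castSucc ≤ (x : ℝ) → False := by
      intro i j hij x hx hx'
      have : a i.succ ≤ a j.castSucc := ha.monotone (by
        rw [Fin.le_def]; simpa using hij)
      linarith
    intro i j hij
    rw [Function.onFun, Set.disjoint_left]
    rintro x ⟨hx1, hx2⟩ ⟨hx3, hx4⟩
    rcases lt_or_gt_of_ne hij with hlt | hlt
    · exact key i j hlt x hx2 hx3
    · exact key j i hlt x hx4 hx1
  · refine eq_univ_of_forall fun x => ?_
    by_contra hx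
    simp only [mem_iUnion, mem_ofPred_eq, not_exists, not_and, not_lt] at hx
    have : ∀ j : Fin (N + 1), a j ≤ (x : ℝ) := by
      intro j
      induction j using Fin.induction with
      | zero => rw [h0]; exact x.2.1
      | succ i hi => exact hx i hi
    have h2 := this (Fin.last N)
    rw [h1] at h2
    exact absurd x.2.2 (not_lt.mpr h2)
  · rintro i x ⟨hx1, hx2⟩
    exact h i x hx1 hx2
  · intro i x
    constructor
    · rintro ⟨h3, h4⟩
      have hlo : 0 ≤ a i.castSucc := h0 ▸ ha.monotone (Fin.zero_le _)
      have hhi : a i.succ ≤ 1 := h1 ▸ ha.monotone (Fin.le_last _)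
      -- Translating $Tx$ back lands in the $i$-th piece at a point with the same image as $x$;
      -- injectivity of $T$ identifies it with $x$.
      let z : UnitIco := ⟨(T x : ℝ) - σ i, hlo.trans h3, h4.trans_le hhi⟩
      have hz : T z = T x := by
        apply Subtype.ext
        rw [h i z h3 h4]
        simp [z]
      have : z = x := T.injective hz
      rw [← this]
      exact ⟨h3, h4⟩
    · rintro ⟨h3, h4⟩
      have := h i x h3 h4
      simp only [mem_ofPred_eq, this, add_sub_cancel_right]
      exact ⟨h3, h4⟩
  · rintro i x ⟨h3, h4⟩
    exact ⟨a i.succ - x, by linarith, fun y hy hy' => ⟨h3.trans hy, by linarith⟩⟩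

theorem IsIET.finite_displacement {T : Equiv.Perm UnitIco} (hT : IsIET T) (k : ℕ) :
    (range fun x : UnitIco => ((T^[k] x : UnitIco) : ℝ) - x).Finite := by
  have h1 : (range fun x : UnitIco => (T x : ℝ) - x).Finite := by
    obtain ⟨N, X, Y, σ, -, -, -, hX, h, -⟩ := hT.exists_pieces
    refine (finite_range σ).subset ?_
    rintro _ ⟨x, rfl⟩
    obtain ⟨i, hi⟩ := mem_iUnion.1 (hX.symm ▸ mem_univ x : x ∈ ⋃ i, X i)
    exact ⟨i, by simp only [h i x hi]; ring⟩
  induction k with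
  | zero => exact (finite_singleton (0 : ℝ)).subset (by rintro _ ⟨x, rfl⟩; simp)
  | succ k ih =>
    refine (h1.image2 (· + ·) ih).subset ?_
    rintro _ ⟨x, rfl⟩
    refine ⟨_, ⟨T^[k] x, rfl⟩, _, ⟨x, rfl⟩, ?_⟩
    simp only [Function.iterate_succ_apply']
    ring

theorem IsIET.right_germ {T : Equiv.Perm UnitIco} (hT : IsIET T) (k : ℕ) (x : UnitIco) :
    ∃ ε > 0, ∀ y : UnitIco, (x : ℝ) ≤ y → (y : ℝ) < x + ε →
      ((T^[k] y : UnitIco) : ℝ) = y + ((T^[k] x : UnitIco) - x) := by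
  have h1 : ∀ x : UnitIco, ∃ ε > 0, ∀ y : UnitIco, (x : ℝ) ≤ y → (y : ℝ) < x + ε →
      (T y : ℝ) = y + (T x - x) := by
    intro x
    obtain ⟨N, X, Y, σ, -, -, -, hX, h, -, hr⟩ := hT.exists_pieces
    obtain ⟨i, hi⟩ := mem_iUnion.1 (hX.symm ▸ mem_univ x : x ∈ ⋃ i, X i)
    obtain ⟨ε, hε, hh⟩ := hr i x hi
    refine ⟨ε, hε, fun y hy hy' => ?_⟩
    rw [h i x hi, h i y (hh y hy hy')]
    ring
  induction k with
  | zero => exact ⟨1, one_pos, fun y _ _ => by simp⟩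
  | succ k ih =>
    obtain ⟨ε, hε, h⟩ := ih
    obtain ⟨ε', hε', h'⟩ := h1 (T^[k] x)
    refine ⟨min ε ε', lt_min hε hε', fun y hy hy' => ?_⟩
    have h2 := h y hy (hy'.trans_le (by gcongr; exact min_le_left _ _))
    have h3 : (y : ℝ) < x + ε' := hy'.trans_le (by gcongr; exact min_le_right _ _)
    have h4 := h' (T^[k] y) (by rw [h2]; linarith) (by rw [h2]; linarith)
    rw [Function.iterate_succ_apply', Function.iterate_succ_apply', h4, h2]
    ring

theorem IsIET.measurable {T : Equiv.Perm UnitIco} (hT : IsIET T) : Measurable T := by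
  obtain ⟨N, X, Y, σ, hXm, -, -, hX, h, -⟩ := hT.exists_pieces
  rintro _ ⟨S', hS', rfl⟩
  have : T ⁻¹' (Subtype.val ⁻¹' S') =
      ⋃ i, X i ∩ {x : UnitIco | (x : ℝ) + σ i ∈ S'} := by
    ext x
    simp only [mem_preimage, mem_iUnion, mem_inter_iff, mem_ofPred_eq]
    constructor
    · intro hx
      obtain ⟨i, hi⟩ := mem_iUnion.1 (hX.symm ▸ mem_univ x : x ∈ ⋃ i, X i)
      exact ⟨i, hi, by rwa [← h i x hi]⟩
    · rintro ⟨i, hi, hx⟩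
      rwa [h i x hi]
  rw [this]
  exact MeasurableSet.iUnion fun i => (hXm i).inter
    ((measurable_subtype_coe.add_const _) hS')

theorem measurableEmbedding_coe_unitIco :
    MeasurableEmbedding (Subtype.val : UnitIco → ℝ) :=
  MeasurableEmbedding.subtype_coe measurableSet_Ico

theorem lebesgueIco_apply (S : Set UnitIco) : lebesgueIco S = volume (Subtype.val '' S) :=
  measurableEmbedding_coe_unitIco.comap_apply _ _

instance : IsProbabilityMeasure lebesgueIco :=
  ⟨by rw [lebesgueIco_apply, image_univ, Subtype.range_coe]; simp⟩

theorem IsIET.measurePreserving {T : Equiv.Perm UnitIco} (hT : IsIET T) :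
    MeasurePreserving T lebesgueIco lebesgueIco := by
  obtain ⟨N, X, Y, σ, hXm, hYm, hXd, hX, h, hXY, -⟩ := hT.exists_pieces
  refine ⟨hT.measurable, ?_⟩
  ext S hS
  rw [Measure.map_apply hT.measurable hS]
  have hYd : Pairwise (Function.onFun Disjoint Y) := by
    intro i j hij
    rw [Function.onFun, Set.disjoint_left]
    intro y hy hy'
    obtain ⟨x, rfl⟩ := T.surjective y
    rw [hXY] at hy hy'
    exact Set.disjoint_left.1 (hXd hij) hy hy'
  have hY : (⋃ i, Y i) = univ := by
    refine eq_univ_of_forall fun y => ?_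
    obtain ⟨x, rfl⟩ := T.surjective y
    obtain ⟨i, hi⟩ := mem_iUnion.1 (hX.symm ▸ mem_univ x : x ∈ ⋃ i, X i)
    exact mem_iUnion.2 ⟨i, (hXY i x).2 hi⟩
  have e1 : T ⁻¹' S = ⋃ i, T ⁻¹' S ∩ X i := by rw [← inter_iUnion, hX, inter_univ]
  have e2 : S = ⋃ i, S ∩ Y i := by rw [← inter_iUnion, hY, inter_univ]
  rw [e1, measure_iUnion
    (fun i j hij => (hXd hij).mono inter_subset_right inter_subset_right)
    (fun i => (hT.measurable hS).inter (hXm i))]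
  conv_rhs => rw [e2]
  rw [measure_iUnion
    (fun i j hij => (hYd hij).mono inter_subset_right inter_subset_right)
    (fun i => hS.inter (hYm i))]
  congr 1
  funext i
  rw [lebesgueIco_apply, lebesgueIco_apply]
  have : (Subtype.val '' (T ⁻¹' S ∩ X i) : Set ℝ) =
      (fun x => x + σ i) ⁻¹' (Subtype.val '' (S ∩ Y i)) := by
    ext x
    simp only [mem_image, mem_inter_iff, mem_preimage]
    constructor
    · rintro ⟨z, ⟨hz, hz'⟩, rfl⟩
      exact ⟨T z, ⟨hz, (hXY i z).2 hz'⟩, h i z hz'⟩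
    · rintro ⟨y, ⟨hy, hy'⟩, hyx⟩
      obtain ⟨z, rfl⟩ := T.surjective y
      rw [hXY] at hy'
      refine ⟨z, ⟨hy, hy'⟩, ?_⟩
      rw [h i z hy'] at hyx
      linarith
  rw [this, measure_preimage_add_right]

theorem continuousAt_iterate {T : Equiv.Perm UnitIco} {A : Set ℝ}
    (hdisc : ∀ x : UnitIco, ¬ ContinuousAt T x → (x : ℝ) ∈ A) (k : ℕ) (z : UnitIco)
    (hz : ∀ i < k, ((T^[i] z : UnitIco) : ℝ) ∉ A) : ContinuousAt T^[k] z := by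
  induction k with
  | zero => exact continuousAt_id
  | succ k ih =>
    rw [Function.iterate_succ']
    refine ContinuousAt.comp ?_ (ih fun i hi => hz i (by lia))
    by_contra hc
    exact hz k (by lia) (hdisc _ hc)

/-- An iterate of `T` is a translation on a connected set whose orbit avoids `A`. -/
theorem IsIET.exists_translation {T : Equiv.Perm UnitIco} (hT : IsIET T) {A : Set ℝ}
    (hdisc : ∀ x : UnitIco, ¬ ContinuousAt T x → (x : ℝ) ∈ A) (k : ℕ) {S : Set UnitIco}
    (hS : IsPreconnected S) (hSA : ∀ z ∈ S, ∀ i < k, ((T^[i] z : UnitIco) : ℝ) ∉ A) :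
    ∃ s : ℝ, ∀ z ∈ S, ((T^[k] z : UnitIco) : ℝ) = z + s := by
  have hc : ContinuousOn (fun x : UnitIco => ((T^[k] x : UnitIco) : ℝ) - x) S := by
    intro z hz
    have := continuousAt_iterate hdisc k z (hSA z hz)
    exact ((continuous_subtype_val.continuousAt.comp this).sub
      continuous_subtype_val.continuousAt).continuousWithinAt
  have h1 := hS.image _ hc
  have h2 := ((hT.finite_displacement k).subset (image_subset_range _ S)).countable
  -- A connected set of reals that is countable has at most one point.
  have h3 : ((fun x : UnitIco => ((T^[k] x : UnitIco) : ℝ) - x) '' S).Subsingleton :=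
    h2.isTotallyDisconnected _ subset_rfl h1
  rcases S.eq_empty_or_nonempty with rfl | ⟨z0, hz0⟩
  · exact ⟨0, by simp⟩
  · refine ⟨((T^[k] z0 : UnitIco) : ℝ) - z0, fun z hz => ?_⟩
    have := h3 (mem_image_of_mem _ hz) (mem_image_of_mem _ hz0)
    beta_reduce at this
    linarith

theorem lebesgueIco_between {u v : ℝ} (hu : 0 ≤ u) (hv : v ≤ 1) :
    lebesgueIco {z | u ≤ (z : ℝ) ∧ (z : ℝ) < v} = ENNReal.ofReal (v - u) := by
  have : (Subtype.val '' {z : UnitIco | u ≤ (z : ℝ) ∧ (z : ℝ) < v} : Set ℝ) = Ico u v := by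
    ext x
    constructor
    · rintro ⟨z, hz, rfl⟩
      exact hz
    · intro hx
      exact ⟨⟨x, hu.trans hx.1, hx.2.trans_le hv⟩, hx, rfl⟩
  rw [lebesgueIco_apply, this, Real.volume_Ico]

theorem measurableSet_between (u v : ℝ) :
    MeasurableSet {z : UnitIco | u ≤ (z : ℝ) ∧ (z : ℝ) < v} :=
  (measurableSet_le measurable_const measurable_subtype_coe).inter
    (measurableSet_lt measurable_subtype_coe measurable_const)

/-! ### Ergodic interval exchanges: return times and visits to the singularities -/

theorem Ergodic.measure_compl_eq_zero_of_forward_invariant {T : UnitIco → UnitIco}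
    (hE : Ergodic T lebesgueIco) {Y : Set UnitIco} (hY : MeasurableSet Y)
    (hinv : ∀ x ∈ Y, T x ∈ Y) (h0 : lebesgueIco Y ≠ 0) : lebesgueIco Yᶜ = 0 := by
  rcases hE.ae_empty_or_univ_of_ae_le_preimage hY.nullMeasurableSet
    (LE.le.eventuallyLE (show Y ≤ T ⁻¹' Y from hinv)) with h | h
  · exact absurd (ae_eq_empty.1 h) h0
  · exact ae_eq_univ.1 h

/-- A periodic point carries an interval to its right consisting of points with the same period.
Shortened so that $ke<1$, this interval has a forward invariant union of preimages of measure
strictly between $0$ and $1$. -/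
theorem IsIET.iterate_ne_of_ergodic {T : Equiv.Perm UnitIco} (hT : IsIET T)
    (hE : Ergodic T lebesgueIco) {k : ℕ} (hk : 1 ≤ k) (x : UnitIco) : T^[k] x ≠ x := by
  intro hx
  obtain ⟨ε, hε, h⟩ := hT.right_germ k x
  have hx1 : (x : ℝ) < 1 := x.2.2
  have hkpos : (0 : ℝ) < k := by exact_mod_cast hk
  obtain ⟨e, he0, he1, he2, he3⟩ : ∃ e : ℝ, 0 < e ∧ e ≤ ε ∧ (x : ℝ) + e ≤ 1 ∧ k * e < 1 := by
    refine ⟨min ε (min (1 - x) (1 / (2 * k))), ?_, min_le_left _ _, ?_, ?_⟩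
    · exact lt_min hε (lt_min (by linarith) (by positivity))
    · linarith [(min_le_right ε (min (1 - (x : ℝ)) (1 / (2 * k)))).trans (min_le_left _ _)]
    · have h1 := (min_le_right ε (min (1 - (x : ℝ)) (1 / (2 * k)))).trans (min_le_right _ _)
      calc (k : ℝ) * _ ≤ k * (1 / (2 * k)) := by gcongr
        _ = 1 / 2 := by field_simp
        _ < 1 := by norm_num
  set J : Set UnitIco := {z | (x : ℝ) ≤ z ∧ (z : ℝ) < x + e} with hJ
  have hJm : MeasurableSet J := measurableSet_between _ _
  have hJμ : lebesgueIco J = ENNReal.ofReal e := by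
    rw [hJ, lebesgueIco_between x.2.1 he2]; congr 1; ring
  have hmp := hT.measurePreserving
  set Y : Set UnitIco := ⋃ i ∈ Finset.range k, T^[i] ⁻¹' J with hYdef
  have hYm : MeasurableSet Y := Finset.measurableSet_biUnion _ fun i _ =>
    (hT.measurable.iterate i) hJm
  have hinv : ∀ z ∈ Y, T z ∈ Y := by
    intro z hz
    simp only [hYdef, mem_iUnion, Finset.mem_range, mem_preimage, exists_prop] at hz ⊢
    obtain ⟨i, hi, hz⟩ := hz
    rcases i with _ | i
    · refine ⟨k - 1, by lia, ?_⟩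
      rw [← Function.iterate_succ_apply, Nat.succ_eq_add_one, Nat.sub_add_cancel hk]
      have hz' : z ∈ J := hz
      have : T^[k] z = z := by
        apply Subtype.ext
        rw [h z hz'.1 (by linarith [hz'.2]), hx]
        ring
      rwa [this]
    · exact ⟨i, by lia, by rwa [← Function.iterate_succ_apply]⟩
  have hYle : lebesgueIco Y < 1 := by
    calc lebesgueIco Y ≤ ∑ i ∈ Finset.range k, lebesgueIco (T^[i] ⁻¹' J) :=
          measure_biUnion_finset_le _ _
      _ = ∑ i ∈ Finset.range k, ENNReal.ofReal e := by
          refine Finset.sum_congr rfl fun i _ => ?_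
          rw [(hmp.iterate i).measure_preimage hJm.nullMeasurableSet, hJμ]
      _ = ENNReal.ofReal (k * e) := by
          rw [Finset.sum_const, Finset.card_range, ENNReal.ofReal_mul hkpos.le]; simp
      _ < 1 := by rw [← ENNReal.ofReal_one]; exact (ENNReal.ofReal_lt_ofReal_iff one_pos).2 he3
  have hY0 : lebesgueIco Y ≠ 0 := by
    have : J ⊆ Y := fun z hz => mem_biUnion (Finset.mem_coe.2 (Finset.mem_range.2 hk)) hz
    refine (lt_of_lt_of_le ?_ (measure_mono this)).ne'
    rw [hJμ]; simpa using he0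
  have := hE.measure_compl_eq_zero_of_forward_invariant hYm hinv hY0
  rw [prob_compl_eq_zero_iff hYm] at this
  exact hYle.ne this

/-- The iterates `T^[k]`, `k ≤ n`, act on `[v₁, v₂)` as translations. -/
def TranslatesOn (T : Equiv.Perm UnitIco) (v₁ : UnitIco) (v₂ : ℝ) (n : ℕ) : Prop :=
  v₂ ≤ 1 ∧ ∀ k ≤ n, ∃ s : ℝ, ∀ z : UnitIco, (v₁ : ℝ) ≤ z → (z : ℝ) < v₂ →
    ((T^[k] z : UnitIco) : ℝ) = z + s

theorem TranslatesOn.displacement_eq {T : Equiv.Perm UnitIco} {v₁ : UnitIco} {v₂ : ℝ} {n : ℕ}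
    (h : TranslatesOn T v₁ v₂ n) {k : ℕ} (hk : k ≤ n) {x y : UnitIco} (hx : (v₁ : ℝ) ≤ x)
    (hx' : (x : ℝ) < v₂) (hy : (v₁ : ℝ) ≤ y) (hy' : (y : ℝ) < v₂) :
    ((T^[k] y : UnitIco) : ℝ) = y + ((T^[k] x : UnitIco) - x) := by
  obtain ⟨s, hs⟩ := h.2 k hk
  rw [hs x hx hx', hs y hy hy']
  ring

/-- In an ergodic system, a point cannot return from both sides inside an interval on which the
iterates are translations. -/
theorem TranslatesOn.not_two_sided_return {T : Equiv.Perm UnitIco} (hT : IsIET T)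
    (hE : Ergodic T lebesgueIco) {v₁ : UnitIco} {v₂ : ℝ} {n : ℕ} (h : TranslatesOn T v₁ v₂ n)
    {y : UnitIco} {α β : ℝ} (hα : 0 < α) (hβ : 0 < β) {k₁ k₂ : ℕ} (hk₁ : k₁ ≤ n) (hk₂ : k₂ ≤ n)
    (h₁ : ((T^[k₁] y : UnitIco) : ℝ) = y + α) (h₂ : ((T^[k₂] y : UnitIco) : ℝ) = y - β)
    (hv₂ : (y : ℝ) + α ≤ v₂) (hv₁ : (v₁ : ℝ) < y - β) : False := by
  have hv10 : (0 : ℝ) ≤ v₁ := v₁.2.1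
  have hk₁' : 1 ≤ k₁ := by
    rcases k₁ with _ | k
    · simp at h₁; linarith
    · lia
  have hk₂' : 1 ≤ k₂ := by
    rcases k₂ with _ | k
    · simp at h₂; linarith
    · lia
  set ε : ℝ := y - β - v₁ with hεdef
  have hε : 0 < ε := by linarith
  -- $T^{k_1}$ on $[y-\beta,y)$ and $T^{k_2}$ on $[y,y+\alpha)$ form an exchange of two intervals of
  -- $[y-\beta,y+\alpha)$, so points return there forever. In between, $T^iz=T^iv_1+(z-v_1)\ge
  -- z-v_1\ge\varepsilon$. Hence $[0,\varepsilon)$ is never visited, which ergodicity forbids.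
  have key : ∀ i : ℕ, ∀ z : UnitIco, (y : ℝ) - β ≤ z → (z : ℝ) < y + α →
      ε ≤ (T^[i] z : UnitIco) := by
    intro i
    induction i using Nat.strong_induction_on with
    | _ i ih =>
      intro z hz hz'
      have small : i ≤ n → ε ≤ (T^[i] z : UnitIco) := by
        intro hi
        have e1 := h.displacement_eq hi (x := v₁) (y := z) le_rfl (by linarith) (by linarith)
          (by linarith)
        have e2 : (0 : ℝ) ≤ (T^[i] v₁ : UnitIco) := (T^[i] v₁).2.1
        rw [e1]; linarith
      rcases lt_or_ge (z : ℝ) y with hzy | hzy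
      · rcases lt_or_ge i k₁ with hi | hi
        · exact small (by lia)
        · have e1 := h.displacement_eq hk₁ (x := y) (y := z) (by linarith) (by linarith)
            (by linarith) (by linarith)
          rw [h₁] at e1
          have := ih (i - k₁) (by lia) (T^[k₁] z) (by linarith) (by linarith)
          rwa [← Function.iterate_add_apply, Nat.sub_add_cancel hi] at this
      · rcases lt_or_ge i k₂ with hi | hi
        · exact small (by lia)
        · have e1 := h.displacement_eq hk₂ (x := y) (y := z) (by linarith) (by linarith)
            (by linarith) (by linarith)
          rw [h₂] at e1
          have := ih (i - k₂) (by lia) (T^[k₂] z) (by linarith) (by linarith)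
          rwa [← Function.iterate_add_apply, Nat.sub_add_cancel hi] at this
  set Y : Set UnitIco := ⋂ i : ℕ, T^[i] ⁻¹' {z | (z : ℝ) < ε}ᶜ with hY
  have hm : MeasurableSet {z : UnitIco | (z : ℝ) < ε} :=
    measurableSet_lt measurable_subtype_coe measurable_const
  have hYm : MeasurableSet Y := MeasurableSet.iInter fun i => (hT.measurable.iterate i) hm.compl
  have hinv : ∀ z ∈ Y, T z ∈ Y := by
    intro z hz
    simp only [hY, mem_iInter, mem_preimage] at hz ⊢
    intro i
    rw [← Function.iterate_succ_apply]
    exact hz _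
  have hJ : {z : UnitIco | (y : ℝ) - β ≤ z ∧ (z : ℝ) < y + α} ⊆ Y := by
    rintro z ⟨hz, hz'⟩
    simp only [hY, mem_iInter, mem_preimage, mem_compl_iff, mem_ofPred_eq, not_lt]
    exact fun i => key i z hz hz'
  have hY0 : lebesgueIco Y ≠ 0 := by
    refine (lt_of_lt_of_le ?_ (measure_mono hJ)).ne'
    rw [lebesgueIco_between (by linarith) (by linarith [h.1])]
    simp; linarith
  have h3 := hE.measure_compl_eq_zero_of_forward_invariant hYm hinv hY0
  have h4 : {z : UnitIco | (0 : ℝ) ≤ z ∧ (z : ℝ) < ε} ⊆ Yᶜ := by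
    rintro z ⟨-, hz⟩ hz'
    simp only [hY, mem_iInter, mem_preimage, mem_compl_iff, mem_ofPred_eq, not_lt] at hz'
    exact absurd hz (not_lt.2 (hz' 0))
  have h5 := measure_mono_null h4 h3
  rw [lebesgueIco_between le_rfl (by linarith [h.1])] at h5
  simp at h5
  linarith

/-- Pigeonhole: $N+1$ points in $N$ cells of length $1/N$. -/
theorem exists_close_pair (u : ℕ → UnitIco) {N : ℕ} (hN : 1 ≤ N) :
    ∃ i j, i < j ∧ j ≤ N ∧ |(u j : ℝ) - u i| < 1 / N := by
  have hN' : (0 : ℝ) < N := by exact_mod_cast hN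
  have hmaps : ∀ i ∈ Finset.range (N + 1), ⌊(N : ℝ) * u i⌋₊ ∈ Finset.range N := by
    intro i _
    rw [Finset.mem_range, Nat.floor_lt (mul_nonneg hN'.le (u i).2.1)]
    nlinarith [(u i).2.2]
  obtain ⟨i, hi, j, hj, hij, heq⟩ :=
    Finset.exists_ne_map_eq_of_card_lt_of_maps_to (by simp) hmaps
  have close : |(u j : ℝ) - u i| < 1 / N := by
    have h1 := Nat.floor_le (mul_nonneg hN'.le (u i).2.1)
    have h2 := Nat.lt_floor_add_one ((N : ℝ) * u i)
    have h3 := Nat.floor_le (mul_nonneg hN'.le (u j).2.1)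
    have h4 := Nat.lt_floor_add_one ((N : ℝ) * u j)
    rw [heq] at h1 h2
    rw [abs_lt, lt_div_iff₀ hN', neg_lt, ← neg_sub (u i : ℝ), neg_neg, lt_div_iff₀ hN']
    constructor <;> nlinarith
  rw [Finset.mem_range] at hi hj
  rcases lt_or_gt_of_ne hij with h | h
  · exact ⟨i, j, h, by lia, close⟩
  · exact ⟨j, i, h, by lia, by rwa [abs_sub_comm]⟩

/-- Closeness of two orbits at time $i$ goes back to time $0$: the candidate $y+\sigma$ still lies
in the interval, has the right image, and $T^i$ is injective. -/
theorem TranslatesOn.pull_back {T : Equiv.Perm UnitIco} {v₁ : UnitIco} {v₂ : ℝ} {n : ℕ}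
    (h : TranslatesOn T v₁ v₂ n) {y w : UnitIco} {i : ℕ} (hi : i ≤ n) (hy : (v₁ : ℝ) ≤ y)
    (hy' : (y : ℝ) < v₂) {σ : ℝ} (hw : ((T^[i] w : UnitIco) : ℝ) = (T^[i] y : UnitIco) + σ)
    (h1 : (v₁ : ℝ) ≤ y + σ) (h2 : (y : ℝ) + σ < v₂) : (w : ℝ) = y + σ := by
  have hv10 : (0 : ℝ) ≤ v₁ := v₁.2.1
  let z : UnitIco := ⟨(y : ℝ) + σ, by linarith, by linarith [h.1]⟩
  have hz := h.displacement_eq hi hy hy' (y := z) h1 h2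
  have : w = z := by
    apply T.injective.iterate i
    apply Subtype.ext
    rw [hw, hz]
    simp only [z]; ring
  rw [this]

/-- An interval on which the iterates up to the first return time `p` are translations has length
at most `4 / p`. -/
theorem TranslatesOn.mul_length_le {T : Equiv.Perm UnitIco} (hT : IsIET T)
    (hE : Ergodic T lebesgueIco) {v₁ : UnitIco} {v₂ : ℝ} {p : ℕ} (h : TranslatesOn T v₁ v₂ p)
    {x : UnitIco} (hx : (v₁ : ℝ) ≤ x) (hx' : (x : ℝ) < v₂) {δ : ℝ}
    (hp : IsLeast {k : ℕ | 1 ≤ k ∧ |((T^[k] x : UnitIco) : ℝ) - x| < δ} p) :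
    p * (v₂ - v₁) ≤ 4 := by
  by_contra! hcon
  have hv10 : (0 : ℝ) ≤ v₁ := v₁.2.1
  have hv2 := h.1
  set w := v₂ - v₁ with hw
  have hw0 : 0 < w := by linarith
  have hp2 : 2 ≤ p := by
    by_contra hlt
    have : p = 1 := le_antisymm (by lia) hp.1.1
    rw [this] at hcon
    simp at hcon
    linarith
  let y : UnitIco := ⟨(v₁ : ℝ) + w / 2, by linarith, by linarith⟩
  have hy : (y : ℝ) = v₁ + w / 2 := rfl
  -- The points $y,\dots,T^{p-1}y$ are used, so that $j-i<p$ and minimality of $p$ applies to the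
  -- return $\sigma$ found here. Starting from the midpoint keeps $y+\sigma$ in the interval.
  obtain ⟨i, j, hij, hj, hclose⟩ := exists_close_pair (fun i => T^[i] y) (N := p - 1) (by lia)
  have hbound : (1 : ℝ) / ((p - 1 : ℕ) : ℝ) < w / 2 := by
    have e : ((p - 1 : ℕ) : ℝ) = p - 1 := by push_cast [Nat.cast_sub hp.1.1]; ring
    have hp2' : (2 : ℝ) ≤ p := by exact_mod_cast hp2
    rw [e, div_lt_iff₀ (by linarith)]
    nlinarith
  set σ : ℝ := ((T^[j] y : UnitIco) : ℝ) - (T^[i] y : UnitIco) with hσ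
  have hσw : |σ| < w / 2 := hclose.trans hbound
  obtain ⟨hσ1, hσ2⟩ := abs_lt.1 hσw
  have hTq : ((T^[j - i] y : UnitIco) : ℝ) = y + σ := by
    refine h.pull_back (i := i) (by lia) (by linarith) (by linarith) ?_ (by linarith) (by linarith)
    rw [← Function.iterate_add_apply, Nat.add_sub_cancel' hij.le, hσ]
    ring
  set τ : ℝ := ((T^[p] x : UnitIco) : ℝ) - x with hτ
  have hTp : ((T^[p] y : UnitIco) : ℝ) = y + τ :=
    h.displacement_eq le_rfl hx hx' (by linarith) (by linarith)
  have hτδ : |τ| < δ := hp.1.2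
  have hσδ : δ ≤ |σ| := by
    by_contra! hlt
    have e := h.displacement_eq (k := j - i) (by lia) hx hx' (y := y) (by linarith) (by linarith)
    have : p ≤ j - i := hp.2 ⟨by lia, by
      rw [hTq] at e
      have : ((T^[j - i] x : UnitIco) : ℝ) - x = σ := by linarith
      rwa [this]⟩
    lia
  have hτ0 : τ ≠ 0 := by
    intro h0
    rw [h0, add_zero] at hTp
    exact hT.iterate_ne_of_ergodic hE hp.1.1 y (Subtype.ext hTp)
  have hσ0 : σ ≠ 0 := by
    intro h0
    rw [h0, add_zero] at hTq
    exact hT.iterate_ne_of_ergodic hE (by lia) y (Subtype.ext hTq)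
  have hτσ : |τ| < |σ| := hτδ.trans_le hσδ
  have hTpq : ((T^[p - (j - i)] y : UnitIco) : ℝ) = y + (τ - σ) := by
    have e := h.displacement_eq (k := p - (j - i)) (by lia) (x := y) (y := T^[j - i] y)
      (by linarith) (by linarith) (by linarith) (by linarith)
    rw [← Function.iterate_add_apply, Nat.sub_add_cancel (by lia), hTp, hTq] at e
    linarith
  -- The displacements $\tau$ (time $p$), $\sigma$ (time $j-i$) and $\tau-\sigma$ (time $p-(j-i)$)
  -- satisfy $|\tau|<|\sigma|$. If $\sigma,\tau$ have opposite signs they are a two-sided return;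
  -- otherwise $\tau$ and $\tau-\sigma$ are.
  rcases lt_or_gt_of_ne hσ0 with hs | hs <;> rcases lt_or_gt_of_ne hτ0 with ht | ht
  · rw [abs_of_neg hs, abs_of_neg ht] at hτσ
    exact h.not_two_sided_return hT hE (α := τ - σ) (β := -τ) (by linarith) (by linarith)
      (k₁ := p - (j - i)) (k₂ := p) (by lia) le_rfl hTpq (by rw [hTp]; ring) (by linarith)
      (by linarith)
  · rw [abs_of_neg hs, abs_of_pos ht] at hτσ
    exact h.not_two_sided_return hT hE (α := τ) (β := -σ) (by linarith) (by linarith)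
      (k₁ := p) (k₂ := j - i) le_rfl (by lia) hTp (by rw [hTq]; ring) (by linarith)
      (by linarith)
  · rw [abs_of_pos hs, abs_of_neg ht] at hτσ
    exact h.not_two_sided_return hT hE (α := σ) (β := -τ) (by linarith) (by linarith)
      (k₁ := j - i) (k₂ := p) (by lia) le_rfl hTq (by rw [hTp]; ring) (by linarith)
      (by linarith)
  · rw [abs_of_pos hs, abs_of_pos ht] at hτσ
    exact h.not_two_sided_return hT hE (α := τ) (β := σ - τ) (by linarith) (by linarith)
      (k₁ := p) (k₂ := p - (j - i)) le_rfl (by lia) hTp (by rw [hTpq]; ring) (by linarith)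
      (by linarith)

/-- The first return time is shared by all points far enough inside the interval and is carried
along by $T^l$; a margin of $2\delta$ leaves room for a displacement below $\delta$. When $T^lv_1$
is a cut point $a$, this shows that $p$ depends only on $a$ and $\delta$. -/
theorem TranslatesOn.isLeast_return {T : Equiv.Perm UnitIco} {v₁ : UnitIco} {v₂ : ℝ} {p : ℕ}
    (h : TranslatesOn T v₁ v₂ p) {x : UnitIco} (hx : (v₁ : ℝ) ≤ x) (hx' : (x : ℝ) < v₂) {δ : ℝ}
    (hδ0 : 0 < δ) (hδ : 4 * δ ≤ v₂ - v₁)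
    (hp : IsLeast {k : ℕ | 1 ≤ k ∧ |((T^[k] x : UnitIco) : ℝ) - x| < δ} p) {l : ℕ} (hl : l < p) :
    ∃ z : UnitIco, (z : ℝ) = (T^[l] v₁ : UnitIco) + 2 * δ ∧
      IsLeast {k : ℕ | 1 ≤ k ∧ |((T^[k] z : UnitIco) : ℝ) - z| < δ} p := by
  have hv10 : (0 : ℝ) ≤ v₁ := v₁.2.1
  have hv2 := h.1
  let z : UnitIco := ⟨(v₁ : ℝ) + 2 * δ, by linarith, by linarith⟩
  have hz : (z : ℝ) = v₁ + 2 * δ := rfl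
  have e0 := h.displacement_eq hl.le (x := v₁) (y := z) le_rfl (by linarith) (by linarith)
    (by linarith)
  refine ⟨T^[l] z, by rw [e0, hz]; ring, ⟨hp.1.1, ?_⟩, ?_⟩
  · have e1 := h.displacement_eq le_rfl hx hx' (y := z) (by linarith) (by linarith)
    obtain ⟨h1, h2⟩ := abs_lt.1 hp.1.2
    have e2 := h.displacement_eq hl.le (x := z) (y := T^[p] z) (by linarith) (by linarith)
      (by linarith) (by linarith)
    rw [← Function.iterate_add_apply, add_comm p l, Function.iterate_add_apply, e2, e1, abs_lt]
    constructor <;> linarith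
  · rintro q ⟨hq, hqδ⟩
    by_contra! hlt
    obtain ⟨h1, h2⟩ := abs_lt.1 hqδ
    have e1 : ((T^[q] z : UnitIco) : ℝ) =
        z + (((T^[q] (T^[l] z) : UnitIco) : ℝ) - (T^[l] z : UnitIco)) := by
      refine h.pull_back (i := l) hl.le (by linarith) (by linarith) ?_ (by linarith) (by linarith)
      rw [← Function.iterate_add_apply, add_comm l q, Function.iterate_add_apply]
      ring
    have e2 := h.displacement_eq hlt.le hx hx' (y := z) (by linarith) (by linarith)
    have : p ≤ q := hp.2 ⟨hq, by rw [abs_lt]; constructor <;> linarith⟩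
    lia

/-- The points whose orbit meets `A₀` before time `n`. -/
def cutSet (T : Equiv.Perm UnitIco) (A₀ : Set UnitIco) (n : ℕ) : Set UnitIco :=
  {c | ∃ i < n, T^[i] c ∈ A₀}

theorem finite_cutSet (T : Equiv.Perm UnitIco) {A₀ : Set UnitIco} (hA₀ : A₀.Finite) (n : ℕ) :
    (cutSet T A₀ n).Finite := by
  have : cutSet T A₀ n = ⋃ i ∈ Finset.range n, T^[i] ⁻¹' A₀ := by
    ext c; simp [cutSet]
  rw [this]
  exact Set.Finite.biUnion (Finset.finite_toSet _) fun i _ =>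
    hA₀.preimage (T.injective.iterate i).injOn

theorem isPreconnected_unitIco {S : Set UnitIco} (hS : (Subtype.val '' S : Set ℝ).OrdConnected) :
    IsPreconnected S :=
  (Topology.IsInducing.subtypeVal.isPreconnected_image).1 hS.isPreconnected

theorem exists_gap (T : Equiv.Perm UnitIco) {A₀ : Set UnitIco} (hA₀ : A₀.Finite)
    (h0 : ⟨0, by simp⟩ ∈ A₀) {n : ℕ} (hn : 1 ≤ n) (x : UnitIco) :
    ∃ (u₁ : UnitIco) (u₂ : ℝ), (u₁ : ℝ) ≤ x ∧ (x : ℝ) < u₂ ∧ u₂ ≤ 1 ∧ u₁ ∈ cutSet T A₀ n ∧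
      (u₂ = 1 ∨ ∃ c ∈ cutSet T A₀ n, (c : ℝ) = u₂) ∧
      ∀ c ∈ cutSet T A₀ n, (c : ℝ) ≤ u₁ ∨ u₂ ≤ c := by
  have hfin := finite_cutSet T hA₀ n
  obtain ⟨u₁, ⟨hu, hux⟩, hmax⟩ := Set.exists_max_image (cutSet T A₀ n ∩ {c | (c : ℝ) ≤ x})
    (fun c => (c : ℝ)) (hfin.subset inter_subset_left)
    ⟨⟨0, by simp⟩, ⟨0, by lia, h0⟩, x.2.1⟩
  by_cases hne : (cutSet T A₀ n ∩ {c | (x : ℝ) < c}).Nonempty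
  · obtain ⟨c₂, ⟨hc, hcx⟩, hmin⟩ := Set.exists_min_image (cutSet T A₀ n ∩ {c | (x : ℝ) < c})
      (fun c => (c : ℝ)) (hfin.subset inter_subset_left) hne
    refine ⟨u₁, c₂, hux, hcx, c₂.2.2.le, hu, Or.inr ⟨c₂, hc, rfl⟩, fun c hcc => ?_⟩
    rcases le_or_gt (c : ℝ) x with h | h
    · exact Or.inl (hmax c ⟨hcc, h⟩)
    · exact Or.inr (hmin c ⟨hcc, h⟩)
  · refine ⟨u₁, 1, hux, x.2.2, le_rfl, hu, Or.inl rfl, fun c hcc => ?_⟩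
    rcases le_or_gt (c : ℝ) x with h | h
    · exact Or.inl (hmax c ⟨hcc, h⟩)
    · exact absurd ⟨c, hcc, h⟩ hne

/-- Between consecutive cut points no orbit meets a discontinuity before time $n$, so the iterates
are translations on the open gap. Right-continuity of $T$ adds the left endpoint. -/
theorem translatesOn_gap {T : Equiv.Perm UnitIco} (hT : IsIET T) {A : Set ℝ}
    (hdisc : ∀ x : UnitIco, ¬ ContinuousAt T x → (x : ℝ) ∈ A) {A₀ : Set UnitIco}
    (hAA : ∀ x : UnitIco, (x : ℝ) ∈ A → x ∈ A₀) {n : ℕ} {u₁ : UnitIco} {u₂ : ℝ} (hu₂ : u₂ ≤ 1)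
    (hu : (u₁ : ℝ) < u₂) (hgap : ∀ c ∈ cutSet T A₀ n, (c : ℝ) ≤ u₁ ∨ u₂ ≤ c) :
    TranslatesOn T u₁ u₂ n := by
  have hu0 : (0 : ℝ) ≤ u₁ := u₁.2.1
  refine ⟨hu₂, fun k hk => ?_⟩
  have hS : IsPreconnected {z : UnitIco | (u₁ : ℝ) < z ∧ (z : ℝ) < u₂} := by
    apply isPreconnected_unitIco
    have : (Subtype.val '' {z : UnitIco | (u₁ : ℝ) < z ∧ (z : ℝ) < u₂} : Set ℝ) = Ioo (u₁ : ℝ) u₂ := by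
      ext x
      constructor
      · rintro ⟨z, hz, rfl⟩
        exact hz
      · intro hx
        exact ⟨⟨x, hu0.trans hx.1.le, hx.2.trans_le hu₂⟩, hx, rfl⟩
    rw [this]
    exact ordConnected_Ioo
  obtain ⟨s, hs⟩ := hT.exists_translation hdisc k hS (by
    rintro z ⟨hz1, hz2⟩ i hi hmem
    rcases hgap z ⟨i, by lia, hAA _ hmem⟩ with h | h <;> linarith)
  obtain ⟨ε, hε, hg⟩ := hT.right_germ k u₁
  refine ⟨s, fun z hz hz' => ?_⟩
  rcases hz.eq_or_lt with h | h
  · obtain ⟨y, hy1, hy2⟩ := exists_between (lt_min (show (u₁ : ℝ) < u₁ + ε by linarith) hu)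
    let y' : UnitIco := ⟨y, hu0.trans hy1.le, by linarith [hy2.trans_le (min_le_right _ _)]⟩
    have e1 := hg y' hy1.le (hy2.trans_le (min_le_left _ _))
    have e2 := hs y' ⟨hy1, hy2.trans_le (min_le_right _ _)⟩
    have : z = u₁ := Subtype.ext h.symm
    rw [this]
    linarith
  · exact hs z ⟨h, hz'⟩

/-- The points whose orbit comes within `4 / m` to the right of `A₀` before time `m`. -/
def hitSet (T : Equiv.Perm UnitIco) (A₀ : Set UnitIco) (m : ℕ) : Set UnitIco :=
  {x | ∃ i < m, ∃ a ∈ A₀, (a : ℝ) ≤ (T^[i] x : UnitIco) ∧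
    ((T^[i] x : UnitIco) : ℝ) ≤ a + 4 / m}

theorem measurableSet_hitSet {T : Equiv.Perm UnitIco} (hT : IsIET T) {A₀ : Set UnitIco}
    (hA₀ : A₀.Finite) (m : ℕ) : MeasurableSet (hitSet T A₀ m) := by
  have : hitSet T A₀ m = ⋃ i ∈ Finset.range m, ⋃ a ∈ A₀,
      T^[i] ⁻¹' {z | (a : ℝ) ≤ z ∧ (z : ℝ) ≤ a + 4 / m} := by
    ext c
    simp only [hitSet, mem_iUnion, Finset.mem_range, exists_prop, mem_preimage, mem_ofPred_eq]
  rw [this]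
  refine Finset.measurableSet_biUnion _ fun i _ => hA₀.measurableSet_biUnion fun a _ =>
    (hT.measurable.iterate i) ?_
  exact (measurableSet_le measurable_const measurable_subtype_coe).inter
    (measurableSet_le measurable_subtype_coe measurable_const)

/-- The left end of the gap around $x$ reaches $A_0$ at some time $l$, so $T^lx$ lies to the right
of that point by at most the gap length. A gap shorter than $4/n$ gives the first case. In a longer
one, the gap for the first $1/n$-return time $p$ of $x$ has length at most $4/p$. -/
theorem mem_hitSet_or_mem_hitSet_return {T : Equiv.Perm UnitIco} (hT : IsIET T)
    (hE : Ergodic T lebesgueIco) {A : Set ℝ}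
    (hdisc : ∀ x : UnitIco, ¬ ContinuousAt T x → (x : ℝ) ∈ A) {A₀ : Set UnitIco}
    (hA₀ : A₀.Finite) (h0 : ⟨0, by simp⟩ ∈ A₀) (hAA : ∀ x : UnitIco, (x : ℝ) ∈ A → x ∈ A₀)
    {n : ℕ} (hn : 1 ≤ n) (x : UnitIco) :
    x ∈ hitSet T A₀ n ∨ ∃ a ∈ A₀, ∃ (z : UnitIco) (p : ℕ), (z : ℝ) = a + 2 * (1 / n) ∧
      IsLeast {k : ℕ | 1 ≤ k ∧ |((T^[k] z : UnitIco) : ℝ) - z| < 1 / n} p ∧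
      x ∈ hitSet T A₀ p := by
  have hn' : (0 : ℝ) < n := by exact_mod_cast hn
  obtain ⟨u₁, u₂, hux, hxu, hu2, ⟨l, hl, hla⟩, hu2c, hgap⟩ := exists_gap T hA₀ h0 hn x
  have hu0 : (0 : ℝ) ≤ u₁ := u₁.2.1
  have htr := translatesOn_gap hT hdisc hAA hu2 (hux.trans_lt hxu) hgap
  rcases lt_or_ge (u₂ - u₁) (4 / n) with hw | hw
  · left
    refine ⟨l, hl, _, hla, ?_, ?_⟩
    · rw [htr.displacement_eq hl.le (x := u₁) (y := x) le_rfl (by linarith) hux hxu]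
      linarith
    · rw [htr.displacement_eq hl.le (x := u₁) (y := x) le_rfl (by linarith) hux hxu]
      linarith
  right
  have hδ : 4 * (1 / (n : ℝ)) ≤ u₂ - u₁ := by rw [← mul_div_assoc, mul_one]; exact hw
  have hδ0 : (0 : ℝ) < 1 / n := by positivity
  set δ : ℝ := 1 / n with hδdef
  set R : Set ℕ := {k : ℕ | 1 ≤ k ∧ |((T^[k] x : UnitIco) : ℝ) - x| < δ} with hR
  -- Pigeonhole gives a close return of the midpoint of the gap, and displacements agree throughout
  -- the gap. Hence $p\le n$.
  have hRn : ∃ k ≤ n, k ∈ R := by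
    let y : UnitIco := ⟨((u₁ : ℝ) + u₂) / 2, by linarith, by linarith⟩
    have hy : (y : ℝ) = (u₁ + u₂) / 2 := rfl
    obtain ⟨i, j, hij, hj, hclose⟩ := exists_close_pair (fun i => T^[i] y) hn
    obtain ⟨hσ1, hσ2⟩ := abs_lt.1 hclose
    have e : ((T^[j - i] y : UnitIco) : ℝ) =
        y + (((T^[j] y : UnitIco) : ℝ) - (T^[i] y : UnitIco)) := by
      refine htr.pull_back (i := i) (by lia) (by linarith) (by linarith) ?_ (by linarith)
        (by linarith)
      rw [← Function.iterate_add_apply, Nat.add_sub_cancel' hij.le]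
      ring
    have e' := htr.displacement_eq (k := j - i) (by lia) (x := y) (y := x) (by linarith)
      (by linarith) hux hxu
    refine ⟨j - i, by lia, by lia, ?_⟩
    rw [e', e, abs_lt]
    constructor <;> linarith
  obtain ⟨k, hkn, hk⟩ := hRn
  have hne : R.Nonempty := ⟨k, hk⟩
  have hp : IsLeast R (sInf R) := ⟨Nat.sInf_mem hne, fun q hq => Nat.sInf_le hq⟩
  set p := sInf R with hpdef
  have hpn : p ≤ n := (hp.2 hk).trans hkn
  have hp1 : 1 ≤ p := hp.1.1
  -- The gap is taken anew with $p$ in place of $n$: there are fewer cut points, so it contains the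
  -- old gap and has length at least $4\delta$.
  obtain ⟨v₁, v₂, hvx, hxv, hv2, ⟨l, hl, hla⟩, hv2c, hgap'⟩ := exists_gap T hA₀ h0 hp1 x
  have htr' := translatesOn_gap hT hdisc hAA hv2 (hvx.trans_lt hxv) hgap'
  have hsub : cutSet T A₀ p ⊆ cutSet T A₀ n := fun c ⟨i, hi, hc⟩ => ⟨i, by lia, hc⟩
  have hv1u : (v₁ : ℝ) ≤ u₁ := by
    rcases hgap v₁ (hsub ⟨l, hl, hla⟩) with h | h
    · exact h
    · linarith
  have huv2 : u₂ ≤ v₂ := by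
    rcases hv2c with h | ⟨c, hc, hcv⟩
    · linarith
    · rcases hgap c (hsub hc) with h | h <;> linarith
  have hδ' : 4 * δ ≤ v₂ - v₁ := by linarith
  obtain ⟨z, hz, hzp⟩ := htr'.isLeast_return hvx hxv hδ0 hδ' hp hl
  have hlen := htr'.mul_length_le hT hE hvx hxv hp
  have hppos : (0 : ℝ) < p := by exact_mod_cast hp1
  have hlen' : v₂ - v₁ ≤ 4 / p := by rw [le_div_iff₀ hppos]; linarith
  refine ⟨_, hla, z, p, hz, hzp, l, hl, _, hla, ?_, ?_⟩
  · rw [htr'.displacement_eq hl.le (x := v₁) (y := x) le_rfl (by linarith) hvx hxv]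
    linarith
  · rw [htr'.displacement_eq hl.le (x := v₁) (y := x) le_rfl (by linarith) hvx hxv]
    linarith

/-- For each $k$ the displacement takes finitely many values, none of them $0$ in the absence of
periodic points. It follows that returns to within a small distance take a long time. -/
theorem IsIET.exists_displacement_lower_bound {T : Equiv.Perm UnitIco} (hT : IsIET T)
    (hE : Ergodic T lebesgueIco) (P : ℕ) :
    ∃ ε > 0, ∀ k, 1 ≤ k → k < P → ∀ z : UnitIco, ε ≤ |((T^[k] z : UnitIco) : ℝ) - z| := by
  induction P with
  | zero => exact ⟨1, one_pos, fun k _ hk => by lia⟩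
  | succ P ih =>
    obtain ⟨ε, hε, h⟩ := ih
    by_cases hP : 1 ≤ P
    · have hfin := hT.finite_displacement P
      obtain ⟨_, ⟨z0, rfl⟩, hmin⟩ := Set.exists_min_image _ (fun t : ℝ => |t|) hfin
        ⟨_, ⟨⟨0, by simp⟩, rfl⟩⟩
      refine ⟨min ε |((T^[P] z0 : UnitIco) : ℝ) - z0|, lt_min hε ?_, fun k hk hkP z => ?_⟩
      · rw [abs_pos, sub_ne_zero]
        exact fun h => hT.iterate_ne_of_ergodic hE hP z0 (Subtype.ext h)
      · rcases (Nat.lt_succ_iff.1 hkP).eq_or_lt with rfl | hlt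
        · exact (min_le_right _ _).trans (hmin _ ⟨z, rfl⟩)
        · exact (min_le_left _ _).trans (h k hk hlt z)
    · exact ⟨1, one_pos, fun k hk hk' => by lia⟩

/-- At infinitely many scales, a definite proportion of orbits comes close to `A₀` in time inverse
to the distance. -/
theorem exists_large_hitSet {T : Equiv.Perm UnitIco} (hT : IsIET T)
    (hE : Ergodic T lebesgueIco) {A : Set ℝ}
    (hdisc : ∀ x : UnitIco, ¬ ContinuousAt T x → (x : ℝ) ∈ A) {A₀ : Set UnitIco}
    (hA₀ : A₀.Finite) (h0 : ⟨0, by simp⟩ ∈ A₀) (hAA : ∀ x : UnitIco, (x : ℝ) ∈ A → x ∈ A₀) :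
    ∃ ρ : ℝ, 0 < ρ ∧ ∀ M : ℕ, ∃ m ≥ M, ENNReal.ofReal ρ ≤ lebesgueIco (hitSet T A₀ m) := by
  classical
  refine ⟨1 / (hA₀.toFinset.card + 1), by positivity, fun M => ?_⟩
  obtain ⟨ε, hε, hdisp⟩ := hT.exists_displacement_lower_bound hE M
  obtain ⟨n, hn⟩ := exists_nat_gt (max (1 / ε) (max M 1))
  have hn1 : (1 : ℝ) < n := ((le_max_right _ _).trans (le_max_right _ _)).trans_lt hn
  have hnM : (M : ℝ) < n := ((le_max_left _ _).trans (le_max_right _ _)).trans_lt hn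
  have hnε : 1 / (n : ℝ) < ε := by
    rw [div_lt_comm₀ (by linarith) hε]
    exact (le_max_left _ _).trans_lt hn
  have hn1' : 1 ≤ n := by exact_mod_cast hn1.le
  -- The only scales that occur are $n$ and the first return times of the points $a+2/n$ with $a\in
  -- A_0$. These are at most $|A_0|+1$ hitting sets covering $[0,1)$, so one has measure at least
  -- $1/(|A_0|+1)$.
  let r : UnitIco → ℕ := fun a => sInf {k : ℕ | ∃ z : UnitIco, (z : ℝ) = a + 2 * (1 / n) ∧ 1 ≤ k ∧
    |((T^[k] z : UnitIco) : ℝ) - z| < 1 / n}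
  let F : Finset ℕ := (insert n (hA₀.toFinset.image r)).filter (M ≤ ·)
  have hcover : (univ : Set UnitIco) ⊆ ⋃ m ∈ F, hitSet T A₀ m := by
    intro x _
    simp only [mem_iUnion, exists_prop]
    rcases mem_hitSet_or_mem_hitSet_return hT hE hdisc hA₀ h0 hAA hn1' x with
      h | ⟨a, ha, z, p, hz, hp, hx⟩
    · refine ⟨n, ?_, h⟩
      simp only [F, Finset.mem_filter, Finset.mem_insert, true_or, true_and]
      exact_mod_cast hnM.le
    · refine ⟨p, ?_, hx⟩
      have hrp : r a = p := by
        have : {k : ℕ | ∃ z : UnitIco, (z : ℝ) = a + 2 * (1 / n) ∧ 1 ≤ k ∧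
            |((T^[k] z : UnitIco) : ℝ) - z| < 1 / n} =
            {k : ℕ | 1 ≤ k ∧ |((T^[k] z : UnitIco) : ℝ) - z| < 1 / n} := by
          ext k
          constructor
          · rintro ⟨z', hz', h⟩
            have : z' = z := Subtype.ext (hz'.trans hz.symm)
            rwa [this] at h
          · intro h
            exact ⟨z, hz, h⟩
        simp only [r, this]
        exact hp.csInf_eq
      simp only [F, Finset.mem_filter, Finset.mem_insert, Finset.mem_image, Finite.mem_toFinset]
      refine ⟨Or.inr ⟨a, ha, hrp⟩, ?_⟩
      by_contra! hlt
      have := hdisp p hp.1.1 hlt z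
      linarith [hp.1.2]
  by_contra! hcon
  have hcard : F.card ≤ hA₀.toFinset.card + 1 :=
    (Finset.card_filter_le _ _).trans ((Finset.card_insert_le _ _).trans
      (by gcongr; exact Finset.card_image_le))
  have hFne : F.Nonempty := ⟨n, by
    simp only [F, Finset.mem_filter, Finset.mem_insert, true_or, true_and]
    exact_mod_cast hnM.le⟩
  have h1 : (1 : ENNReal) < 1 := by
    calc (1 : ENNReal) = lebesgueIco univ := measure_univ.symm
      _ ≤ lebesgueIco (⋃ m ∈ F, hitSet T A₀ m) := measure_mono hcover
      _ ≤ ∑ m ∈ F, lebesgueIco (hitSet T A₀ m) := measure_biUnion_finset_le _ _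
      _ < ∑ m ∈ F, ENNReal.ofReal (1 / (hA₀.toFinset.card + 1)) := by
          refine ENNReal.sum_lt_sum_of_nonempty hFne fun m hm => hcon m ?_
          exact (Finset.mem_filter.1 hm).2
      _ = ENNReal.ofReal (F.card * (1 / (hA₀.toFinset.card + 1))) := by
          rw [Finset.sum_const, ENNReal.ofReal_mul (by positivity)]; simp
      _ ≤ ENNReal.ofReal 1 := by
          apply ENNReal.ofReal_le_ofReal
          rw [mul_one_div, div_le_one (by positivity)]
          exact_mod_cast hcard
      _ = 1 := ENNReal.ofReal_one
  exact lt_irrefl _ h1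

/-- Were $T$ continuous at $d$, it would be a translation near $d$ and send points just left of $d$
below $0$. Such points exist: $d\ne0$, since $T$ has no fixed point. -/
theorem inverse_zero_mem {T : Equiv.Perm UnitIco} (hT : IsIET T) (hE : Ergodic T lebesgueIco)
    {A : Set ℝ} (hdisc : ∀ x : UnitIco, ¬ ContinuousAt T x → (x : ℝ) ∈ A) {d : UnitIco}
    (hd : (T d : ℝ) = 0) : (d : ℝ) ∈ A := by
  by_contra hdA
  have hc : ContinuousAt T d := by
    by_contra h
    exact hdA (hdisc d h)
  have hd0 : (0 : ℝ) < d := by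
    refine lt_of_le_of_ne d.2.1 fun h => ?_
    exact hT.iterate_ne_of_ergodic hE le_rfl d (Subtype.ext (by simp [hd, ← h]))
  have hfin : (range fun x : UnitIco => (T x : ℝ) - x).Finite := hT.finite_displacement 1
  have hev : ∀ᶠ z in 𝓝 d, (T z : ℝ) - z = T d - d := by
    have hcd : ContinuousAt (fun x : UnitIco => (T x : ℝ) - x) d :=
      (continuous_subtype_val.continuousAt.comp hc).sub continuous_subtype_val.continuousAt
    have hcl : IsClosed ((range fun x : UnitIco => (T x : ℝ) - x) \ {(T d : ℝ) - d}) :=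
      (hfin.subset sdiff_subset).isClosed
    have := hcd.eventually (hcl.isOpen_compl.mem_nhds (by simp))
    filter_upwards [this] with z hz
    by_contra hne
    exact hz ⟨⟨z, rfl⟩, hne⟩
  obtain ⟨e, he, hball⟩ := Metric.eventually_nhds_iff.1 hev
  let t : ℝ := min (d / 2) (e / 2)
  have ht0 : 0 < t := lt_min (by linarith) (by linarith)
  have ht1 : t ≤ d / 2 := min_le_left _ _
  have ht2 : t ≤ e / 2 := min_le_right _ _
  let z : UnitIco := ⟨d - t, by linarith, by linarith [d.2.2]⟩
  have hz : (z : ℝ) = d - t := rfl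
  have h1 := hball (y := z) (by
    rw [Subtype.dist_eq, Real.dist_eq, hz, sub_sub_cancel_left, abs_neg, abs_of_pos ht0]
    linarith)
  have h2 : (0 : ℝ) ≤ T z := (T z).2.1
  linarith

/-- At infinitely many scales, a definite proportion of orbits comes close to the singular set in
time inverse to the distance. -/
theorem exists_frequent_hits {T : Equiv.Perm UnitIco} (hT : IsIET T)
    (hE : Ergodic T lebesgueIco) {A : Set ℝ} (hAfin : A.Finite)
    (hdisc : ∀ x : UnitIco, ¬ ContinuousAt T x → (x : ℝ) ∈ A) :
    ∃ ρ : ℝ, 0 < ρ ∧ ∀ M : ℕ, ∃ m ≥ M, ENNReal.ofReal ρ ≤ lebesgueIco {x : UnitIco |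
      ∃ i ≤ m, ∃ a ∈ A, a ≤ (T^[i] x : UnitIco) ∧ ((T^[i] x : UnitIco) : ℝ) ≤ a + 4 / m} := by
  -- The point $0$ is added so that every point has a cut point to its left. Visits near $0$ are
  -- traded below for visits near $d=T^{-1}0\in A$ one step earlier.
  set A₀ : Set UnitIco := {x | (x : ℝ) ∈ A} ∪ {⟨0, by simp⟩} with hA₀def
  have hA₀ : A₀.Finite :=
    (hAfin.preimage Subtype.val_injective.injOn).union (finite_singleton _)
  obtain ⟨ρ, hρ, h⟩ := exists_large_hitSet hT hE hdisc hA₀ (Or.inr rfl) fun x hx => Or.inl hx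
  refine ⟨ρ, hρ, fun M => ?_⟩
  obtain ⟨d, hd⟩ := T.surjective ⟨0, by simp⟩
  have hd' : (T d : ℝ) = 0 := by rw [hd]
  have hdA := inverse_zero_mem hT hE hdisc hd'
  obtain ⟨ε, hε, hg⟩ := hT.right_germ 1 d
  have hd1 : (d : ℝ) < 1 := d.2.2
  obtain ⟨M', hM'⟩ := exists_nat_gt (max (4 / ε) (4 / (1 - (d : ℝ))))
  obtain ⟨m, hm, hmρ⟩ := h (max M M')
  have hmM' : (M' : ℝ) ≤ m := by exact_mod_cast (le_max_right _ _).trans hm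
  have hpos : (0 : ℝ) < m := by
    have : (0 : ℝ) < 4 / ε := by positivity
    linarith [le_max_left (4 / ε) (4 / (1 - (d : ℝ)))]
  have hmε : 4 / (m : ℝ) < ε := by
    rw [div_lt_comm₀ hpos hε]
    linarith [le_max_left (4 / ε) (4 / (1 - (d : ℝ)))]
  have hmd : 4 / (m : ℝ) < 1 - d := by
    rw [div_lt_comm₀ hpos (by linarith)]
    linarith [le_max_right (4 / ε) (4 / (1 - (d : ℝ)))]
  refine ⟨m, (le_max_left _ _).trans hm, ?_⟩
  -- Passing to $T^{-1}$ of the hitting set leaves the measure unchanged and makes an earlier step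
  -- available; this is why times $i\le m$ are allowed in the conclusion.
  rw [← hT.measurePreserving.measure_preimage
    (measurableSet_hitSet hT hA₀ m).nullMeasurableSet] at hmρ
  refine hmρ.trans (measure_mono ?_)
  rintro y ⟨i, hi, a, ha, h1, h2⟩
  rcases ha with ha | ha
  · exact ⟨i + 1, hi, a, ha, h1, h2⟩
  · rw [mem_singleton_iff] at ha
    subst ha
    refine ⟨i, hi.le, d, hdA, ?_⟩
    rw [← Function.iterate_succ_apply, Function.iterate_succ_apply'] at h1 h2
    set w := T^[i] y with hw
    let z : UnitIco := ⟨d + T w, add_nonneg d.2.1 (T w).2.1, by simp at h2; linarith⟩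
    have hz : (z : ℝ) = d + T w := rfl
    simp only [zero_add] at h1 h2
    have e := hg z (by linarith) (by linarith)
    simp only [Function.iterate_one, hd', hz] at e
    have : z = w := T.injective (Subtype.ext (by rw [e]; ring))
    rw [← this, hz]
    constructor <;> linarith

/-! ### Oscillatory integrals and Lebesgue density -/

/-- Van der Corput's first derivative estimate: integrate by parts with $1/F'$ against $(e^{i\theta
F})'/(i\theta)$. As $F'$ is monotone, the variation of $1/F'$ telescopes and the total is
$2/(|\theta|F'(a))$. -/
theorem norm_integral_exp_le_of_deriv_ge {F F' F'' : ℝ → ℝ} {a b δ θ : ℝ} (hab : a ≤ b)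
    (hF : ∀ x ∈ Icc a b, HasDerivAt F (F' x) x) (hF' : ∀ x ∈ Icc a b, HasDerivAt F' (F'' x) x)
    (hc : ContinuousOn F'' (Icc a b)) (hpos : ∀ x ∈ Icc a b, 0 ≤ F'' x) (hδ : 0 < δ)
    (hlow : ∀ x ∈ Icc a b, δ ≤ F' x) (hθ : θ ≠ 0) :
    ‖∫ x in a..b, Complex.exp (Complex.I * θ * F x)‖ ≤ 2 / (|θ| * δ) := by
  have hθ' : 0 < |θ| := abs_pos.2 hθ
  have hne : ∀ x ∈ Icc a b, F' x ≠ 0 := fun x hx => (hδ.trans_le (hlow x hx)).ne'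
  have hIθ : Complex.I * θ ≠ 0 := mul_ne_zero Complex.I_ne_zero (by exact_mod_cast hθ)
  have huIcc : uIcc a b = Icc a b := uIcc_of_le hab
  have hcF' : ContinuousOn F' (Icc a b) := fun x hx => (hF' x hx).continuousAt.continuousWithinAt
  have hcF : ContinuousOn F (Icc a b) := fun x hx => (hF x hx).continuousAt.continuousWithinAt
  let w : ℝ → ℝ := fun x => -F'' x / F' x ^ 2
  let u : ℝ → ℂ := fun x => ((F' x)⁻¹ : ℝ)
  let v : ℝ → ℂ := fun x => Complex.exp (Complex.I * θ * F x) / (Complex.I * θ)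
  let v' : ℝ → ℂ := fun x => F' x * Complex.exp (Complex.I * θ * F x)
  have hw : ∀ x ∈ Icc a b, HasDerivAt (fun x => (F' x)⁻¹) (w x) x := fun x hx =>
    (hF' x hx).inv (hne x hx)
  have hu : ∀ x ∈ uIcc a b, HasDerivAt u (w x : ℝ) x := fun x hx =>
    (hw x (huIcc ▸ hx)).ofReal_comp
  have hv : ∀ x ∈ uIcc a b, HasDerivAt v (v' x) x := by
    intro x hx
    have h1 := ((((hF x (huIcc ▸ hx)).ofReal_comp).const_mul (Complex.I * θ)).cexp).div_const
      (Complex.I * θ)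
    refine h1.congr_deriv ?_
    rw [div_eq_iff hIθ]
    ring
  have hcw : ContinuousOn w (Icc a b) := hc.neg.div (hcF'.pow 2) fun x hx => pow_ne_zero 2 (hne x hx)
  have hcexp : ContinuousOn (fun x => Complex.exp (Complex.I * θ * F x)) (Icc a b) :=
    (continuousOn_const.mul (Complex.continuous_ofReal.comp_continuousOn hcF)).cexp
  have hwi : IntervalIntegrable w volume a b := (huIcc ▸ hcw).intervalIntegrable
  have hibp := intervalIntegral.integral_mul_deriv_eq_deriv_mul hu hv
    (ContinuousOn.intervalIntegrable (huIcc ▸ Complex.continuous_ofReal.comp_continuousOn hcw))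
    (ContinuousOn.intervalIntegrable
      (huIcc ▸ (Complex.continuous_ofReal.comp_continuousOn hcF').mul hcexp))
  have heq : ∫ x in a..b, Complex.exp (Complex.I * θ * F x) = ∫ x in a..b, u x * v' x := by
    refine intervalIntegral.integral_congr fun x hx => ?_
    have : (F' x : ℂ) ≠ 0 := by exact_mod_cast hne x (huIcc ▸ hx)
    simp only [u, v']
    push_cast
    field_simp
  have hnv : ∀ x, ‖v x‖ = 1 / |θ| := by
    intro x
    have : Complex.I * θ * F x = ((θ * F x : ℝ) : ℂ) * Complex.I := by push_cast; ring
    simp only [v, norm_div, this, Complex.norm_exp_ofReal_mul_I, norm_mul, Complex.norm_I, one_mul,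
      Complex.norm_real, Real.norm_eq_abs]
  have hint : ∫ x in a..b, w x = (F' b)⁻¹ - (F' a)⁻¹ :=
    intervalIntegral.integral_eq_sub_of_hasDerivAt (fun x hx => hw x (huIcc ▸ hx)) hwi
  have h3 : ‖∫ x in a..b, ((w x : ℝ) : ℂ) * v x‖ ≤ ((F' a)⁻¹ - (F' b)⁻¹) * (1 / |θ|) := by
    have e : ((F' a)⁻¹ - (F' b)⁻¹) * (1 / |θ|) = ∫ x in a..b, -w x * (1 / |θ|) := by
      rw [intervalIntegral.integral_mul_const, intervalIntegral.integral_neg, hint]; ring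
    rw [e]
    refine intervalIntegral.norm_integral_le_of_norm_le hab
      (Eventually.of_forall fun x hx => ?_) ((hwi.neg).mul_const _)
    have hx' := Ioc_subset_Icc_self hx
    have hwx : w x ≤ 0 := by
      simp only [w]
      exact div_nonpos_of_nonpos_of_nonneg (by linarith [hpos x hx']) (sq_nonneg _)
    rw [norm_mul, hnv, Complex.norm_real, Real.norm_eq_abs, abs_of_nonpos hwx]
  have hFa := hδ.trans_le (hlow a (left_mem_Icc.2 hab))
  have hFb := hδ.trans_le (hlow b (right_mem_Icc.2 hab))
  have hnu : ∀ x, 0 < F' x → ‖u x‖ = (F' x)⁻¹ := fun x hx => by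
    simp only [u, Complex.norm_real, Real.norm_eq_abs, abs_of_pos (inv_pos.2 hx)]
  have hinv : (F' a)⁻¹ ≤ δ⁻¹ := inv_anti₀ hδ (hlow a (left_mem_Icc.2 hab))
  rw [heq, hibp]
  calc ‖u b * v b - u a * v a - ∫ x in a..b, ((w x : ℝ) : ℂ) * v x‖
      ≤ ‖u b * v b‖ + ‖u a * v a‖ + ‖∫ x in a..b, ((w x : ℝ) : ℂ) * v x‖ :=
        (norm_sub_le _ _).trans (by gcongr; exact norm_sub_le _ _)
    _ ≤ (F' b)⁻¹ * (1 / |θ|) + (F' a)⁻¹ * (1 / |θ|) + ((F' a)⁻¹ - (F' b)⁻¹) * (1 / |θ|) := by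
        rw [norm_mul, norm_mul, hnv, hnv, hnu b hFb, hnu a hFa]
        gcongr
    _ = 2 * (F' a)⁻¹ * (1 / |θ|) := by ring
    _ ≤ 2 * δ⁻¹ * (1 / |θ|) := by gcongr
    _ = 2 / (|θ| * δ) := by field_simp

/-- $F'$ grows at rate at least $c$, so it moves away from $0$ on one side of $y$: to the right if
$F'(y)\ge0$, to the left otherwise. At distance at least $r/2$ it has size at least $cr/2$. The left
case is the right one reflected. -/
theorem exists_small_oscillatory_integral {F F' F'' : ℝ → ℝ} {y r c θ : ℝ} (hr : 0 < r)
    (hc0 : 0 < c) (hF : ∀ x ∈ Ioo (y - r) (y + r), HasDerivAt F (F' x) x)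
    (hF' : ∀ x ∈ Ioo (y - r) (y + r), HasDerivAt F' (F'' x) x)
    (hcont : ContinuousOn F'' (Ioo (y - r) (y + r)))
    (hlow : ∀ x ∈ Ioo (y - r) (y + r), c ≤ F'' x) (hθ : θ ≠ 0) :
    ∃ a b : ℝ, y - r < a ∧ b < y + r ∧ b - a = r / 4 ∧
      ‖∫ x in a..b, Complex.exp (Complex.I * θ * F x)‖ ≤ 4 / (|θ| * c * r) := by
  have main : ∀ {F F' F'' : ℝ → ℝ} {y : ℝ}
      (_ : ∀ x ∈ Ioo (y - r) (y + r), HasDerivAt F (F' x) x)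
      (_ : ∀ x ∈ Ioo (y - r) (y + r), HasDerivAt F' (F'' x) x)
      (_ : ContinuousOn F'' (Ioo (y - r) (y + r)))
      (_ : ∀ x ∈ Ioo (y - r) (y + r), c ≤ F'' x), 0 ≤ F' y →
      ‖∫ x in (y + r / 2)..(y + 3 * r / 4), Complex.exp (Complex.I * θ * F x)‖ ≤
        4 / (|θ| * c * r) := by
    intro F F' F'' y hF hF' hcont hlow h0
    have hsub : Icc (y + r / 2) (y + 3 * r / 4) ⊆ Ioo (y - r) (y + r) := fun x hx =>
      ⟨by linarith [hx.1], by linarith [hx.2]⟩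
    have h1 := norm_integral_exp_le_of_deriv_ge (a := y + r / 2) (b := y + 3 * r / 4)
      (δ := c * (r / 2)) (by linarith) (fun x hx => hF x (hsub hx)) (fun x hx => hF' x (hsub hx))
      (hcont.mono hsub) (fun x hx => hc0.le.trans (hlow x (hsub hx))) (by positivity) (by
        intro x hx
        have hy : y ∈ Ioo (y - r) (y + r) := ⟨by linarith, by linarith⟩
        have := (convex_Ioo (y - r) (y + r)).mul_sub_le_image_sub_of_le_deriv (f := F') (C := c)
          (fun z hz => (hF' z hz).continuousAt.continuousWithinAt)
          (fun z hz => (hF' z (interior_subset hz)).differentiableAt.differentiableWithinAt)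
          (fun z hz => by rw [(hF' z (interior_subset hz)).deriv]; exact hlow z (interior_subset hz))
          y hy x (hsub hx) (by linarith [hx.1])
        have h2 : c * (r / 2) ≤ c * (x - y) := by
          have := hx.1
          gcongr
          linarith
        linarith) hθ
    refine h1.trans (le_of_eq ?_)
    have : |θ| ≠ 0 := abs_ne_zero.2 hθ
    field_simp
    norm_num
  rcases le_total 0 (F' y) with h | h
  · exact ⟨y + r / 2, y + 3 * r / 4, by linarith, by linarith, by ring, main hF hF' hcont hlow h⟩
  · refine ⟨y - 3 * r / 4, y - r / 2, by linarith, by linarith, by ring, ?_⟩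
    have hmem : ∀ x ∈ Ioo (-y - r) (-y + r), -x ∈ Ioo (y - r) (y + r) := fun x hx =>
      ⟨by linarith [hx.2], by linarith [hx.1]⟩
    have := main (F := fun x => F (-x)) (F' := fun x => -F' (-x)) (F'' := fun x => F'' (-x))
      (y := -y) (fun x hx => by
        exact ((hF (-x) (hmem x hx)).scomp x (hasDerivAt_neg x)).congr_deriv (by simp))
      (fun x hx => by
        exact ((hF' (-x) (hmem x hx)).scomp x (hasDerivAt_neg x)).neg.congr_deriv (by simp))
      (hcont.comp continuousOn_neg hmem) (fun x hx => hlow _ (hmem x hx)) (by simpa using h)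
    rw [intervalIntegral.integral_comp_neg (fun x => Complex.exp (Complex.I * θ * F x))] at this
    convert this using 4 <;> ring

/-- Almost every point is a Lebesgue point of $H$, and almost everywhere convergence of the mean
oscillation implies convergence in measure. -/
theorem tendsto_measure_oscillation {H : ℝ → ℂ} (hH : Measurable H) (hb : ∀ x, ‖H x‖ ≤ 1)
    {r : ℕ → ℝ} (hr0 : ∀ m, 0 < r m) (hr : Tendsto r atTop (𝓝 0)) {κ : ℝ} (hκ : 0 < κ) :
    Tendsto (fun m => lebesgueIco {x : UnitIco |
      κ * r m ≤ ∫ t in (-r m)..(r m), ‖H (x + t) - H x‖}) atTop (𝓝 0) := by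
  have hloc : LocallyIntegrable H volume := fun x =>
    ⟨Metric.closedBall x 1, Metric.closedBall_mem_nhds x one_pos,
      Measure.integrableOn_of_bounded (M := 1) (by
        rw [Real.volume_closedBall]; exact ENNReal.ofReal_ne_top) hH.aestronglyMeasurable
        (Eventually.of_forall hb)⟩
  have h1 := IsUnifLocDoublingMeasure.ae_tendsto_average_norm_sub volume hloc 1
  have hr' : Tendsto r atTop (𝓝[>] 0) :=
    tendsto_nhdsWithin_iff.2 ⟨hr, Eventually.of_forall hr0⟩
  have heq : ∀ x : ℝ, ∀ m, (r m)⁻¹ * ∫ t in (-r m)..(r m), ‖H (x + t) - H x‖ =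
      2 * ⨍ y in Metric.closedBall x (r m), ‖H y - H x‖ := by
    intro x m
    have hpos := hr0 m
    rw [setAverage_eq, Real.closedBall_eq_Icc,
      intervalIntegral.integral_comp_add_left (fun y => ‖H y - H x‖),
      intervalIntegral.integral_of_le (by linarith), integral_Icc_eq_integral_Ioc,
      measureReal_def, Real.volume_Icc, ENNReal.toReal_ofReal (by linarith), smul_eq_mul,
      ← sub_eq_add_neg, show x + r m - (x - r m) = 2 * r m by ring]
    generalize ∫ y in Ioc (x - r m) (x + r m), ‖H y - H x‖ = I
    field_simp
  have h2 : ∀ᵐ x : UnitIco ∂lebesgueIco, Tendsto (fun m =>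
      (r m)⁻¹ * ∫ t in (-r m)..(r m), ‖H (x + t) - H x‖) atTop (𝓝 0) := by
    have h3 : ∀ᵐ x : ℝ, Tendsto (fun m =>
        (r m)⁻¹ * ∫ t in (-r m)..(r m), ‖H (x + t) - H x‖) atTop (𝓝 0) := by
      filter_upwards [h1] with x hx
      have := (hx (fun _ => x) r hr' (Eventually.of_forall fun m => by
        simpa using (hr0 m).le)).const_mul 2
      simp only [heq]
      simpa using this
    rw [ae_iff, lebesgueIco_apply]
    refine measure_mono_null ?_ (ae_iff.1 h3)
    rintro _ ⟨x, hx, rfl⟩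
    exact hx
  have hmeas : ∀ m, StronglyMeasurable fun x : UnitIco =>
      (r m)⁻¹ * ∫ t in (-r m)..(r m), ‖H (x + t) - H x‖ := by
    intro m
    refine StronglyMeasurable.const_mul ?_ _
    simp only [intervalIntegral.integral_of_le (show -r m ≤ r m by linarith [hr0 m])]
    refine StronglyMeasurable.integral_prod_right (f := fun (x : UnitIco) (t : ℝ) =>
      ‖H (x + t) - H x‖) ?_
    apply Measurable.stronglyMeasurable
    have m1 : Measurable fun p : UnitIco × ℝ => (p.1 : ℝ) :=
      measurable_subtype_coe.comp measurable_fst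
    exact ((hH.comp (m1.add measurable_snd)).sub (hH.comp m1)).norm
  have h4 := tendstoInMeasure_of_tendsto_ae (fun m => (hmeas m).aestronglyMeasurable) h2
  rw [tendstoInMeasure_iff_norm] at h4
  refine tendsto_of_tendsto_of_tendsto_of_le_of_le tendsto_const_nhds (h4 κ hκ)
    (fun _ => zero_le) fun m => measure_mono fun x hx => ?_
  simp only [mem_ofPred_eq, sub_zero] at hx ⊢
  refine le_trans ?_ (le_abs_self _)
  rw [inv_mul_eq_div, le_div_iff₀ (hr0 m)]
  exact hx

/-- Integrate $H(z+c)=E(z)H(z)$ over $[a,b]$, replacing $H(z+c)$ by $H(y+c)$ and $H(z)$ by $H(y)$;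
each replacement costs at most $\kappa r$. -/
theorem length_le_of_almost_constant {H E : ℝ → ℂ} (hH : Measurable H) (hb : ∀ x, ‖H x‖ ≤ 1)
    {y r c a b κ : ℝ} (hra : y - r < a) (hab : a ≤ b) (hbr : b < y + r)
    (hE : ContinuousOn E (Icc a b)) (hE1 : ∀ x, ‖E x‖ = 1)
    (hrel : ∀ᵐ z : ℝ, z ∈ Ioo (y - r) (y + r) → H (z + c) = E z * H z)
    (h1 : ∫ t in (-r)..r, ‖H (y + t) - H y‖ ≤ κ * r)
    (h2 : ∫ t in (-r)..r, ‖H (y + c + t) - H (y + c)‖ ≤ κ * r) :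
    (b - a) * ‖H (y + c)‖ ≤ ‖∫ x in a..b, E x‖ + 2 * (κ * r) := by
  have hbd : ∀ (g : ℝ → ℂ) (C : ℝ) (p q : ℝ), Measurable g → (∀ x, ‖g x‖ ≤ C) →
      IntervalIntegrable g volume p q := by
    intro g C p q hg hC
    exact (intervalIntegrable_const (c := C)).mono_fun' hg.aestronglyMeasurable
      (Eventually.of_forall hC)
  have hcdiff : ∀ w p q : ℝ, IntervalIntegrable (fun t => H (w + t) - H w) volume p q := by
    intro w p q
    exact hbd _ 2 p q ((hH.comp (measurable_const_add w)).sub_const _) fun x =>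
      (norm_sub_le _ _).trans (by linarith [hb (w + x), hb w])
  have hmono : ∀ w : ℝ, ∫ x in a..b, ‖H (w + (x - y)) - H w‖ ≤
      ∫ t in (-r)..r, ‖H (w + t) - H w‖ := by
    intro w
    rw [intervalIntegral.integral_comp_sub_right (fun t => ‖H (w + t) - H w‖)]
    exact intervalIntegral.integral_mono_interval (by linarith) (by linarith) (by linarith)
      (Eventually.of_forall fun t => norm_nonneg _) (hcdiff w _ _).norm
  have hshift : ∀ w : ℝ, IntervalIntegrable (fun x => H (w + (x - y)) - H w) volume a b := by
    intro w
    exact hbd _ 2 a b ((hH.comp ((measurable_id.sub_const y).const_add w)).sub_const _) fun x =>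
      (norm_sub_le _ _).trans (by linarith [hb (w + (x - y)), hb w])
  have hEi : IntervalIntegrable E volume a b := (uIcc_of_le hab ▸ hE).intervalIntegrable
  have hHi : IntervalIntegrable (fun x => H (y + (x - y)) - H y) volume a b := hshift y
  have hEH : IntervalIntegrable (fun x => E x * (H (y + (x - y)) - H y)) volume a b :=
    hHi.continuousOn_mul (uIcc_of_le hab ▸ hE)
  have e1 : ∫ x in a..b, (E x * H y + E x * (H (y + (x - y)) - H y)) =
      ∫ x in a..b, (H (y + c) + (H (y + c + (x - y)) - H (y + c))) := by
    refine intervalIntegral.integral_congr_ae ?_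
    filter_upwards [hrel] with x hx hx'
    rw [uIoc_of_le hab] at hx'
    have := hx ⟨by linarith [hx'.1], by linarith [hx'.2]⟩
    have e : y + c + (x - y) = x + c := by ring
    rw [e, this, add_sub_cancel]
    ring
  rw [intervalIntegral.integral_add (hEi.mul_const _) hEH,
    intervalIntegral.integral_add intervalIntegrable_const (hshift _),
    intervalIntegral.integral_mul_const, intervalIntegral.integral_const] at e1
  have n1 : ‖∫ x in a..b, E x * (H (y + (x - y)) - H y)‖ ≤ κ * r := by
    refine (intervalIntegral.norm_integral_le_integral_norm hab).trans ?_
    simp only [norm_mul, hE1, one_mul]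
    exact (hmono y).trans h1
  have n2 : ‖∫ x in a..b, (H (y + c + (x - y)) - H (y + c))‖ ≤ κ * r :=
    (intervalIntegral.norm_integral_le_integral_norm hab).trans ((hmono _).trans h2)
  have e2 : (b - a) • H (y + c) = (∫ x in a..b, E x) * H y +
      (∫ x in a..b, E x * (H (y + (x - y)) - H y)) -
      ∫ x in a..b, (H (y + c + (x - y)) - H (y + c)) := by
    rw [e1]; ring
  have n3 : ‖(b - a) • H (y + c)‖ = (b - a) * ‖H (y + c)‖ := by
    rw [norm_smul, Real.norm_eq_abs, abs_of_nonneg (by linarith)]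
  rw [← n3, e2]
  have n4 : ‖(∫ x in a..b, E x) * H y‖ ≤ ‖∫ x in a..b, E x‖ := by
    rw [norm_mul]
    exact mul_le_of_le_one_right (norm_nonneg _) (hb y)
  calc _ ≤ ‖(∫ x in a..b, E x) * H y‖ + ‖∫ x in a..b, E x * (H (y + (x - y)) - H y)‖ +
        ‖∫ x in a..b, (H (y + c + (x - y)) - H (y + c))‖ :=
        (norm_sub_le _ _).trans (by gcongr; exact norm_add_le _ _)
    _ ≤ _ := by linarith

/-! ### Excluding large frequencies -/

/-- Induction on time: as long as the iterates translate the ball, its image is a ball of radius $r$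
about $T^iy$, which misses $A$ and hence every discontinuity. -/
theorem IsIET.translation_on_ball {T : Equiv.Perm UnitIco} (hT : IsIET T) {A : Set ℝ}
    (hdisc : ∀ x : UnitIco, ¬ ContinuousAt T x → (x : ℝ) ∈ A) {y : UnitIco} {r : ℝ} (hr0 : 0 < r)
    {N : ℕ} (hr : ∀ i < N, ∀ a ∈ A, r ≤ |((T^[i] y : UnitIco) : ℝ) - a|) {k : ℕ} (hk : k ≤ N)
    {z : UnitIco} (hz : |(z : ℝ) - y| < r) :
    ((T^[k] z : UnitIco) : ℝ) = z + ((T^[k] y : UnitIco) - y) := by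
  induction k using Nat.strong_induction_on generalizing z with
  | _ k ih =>
    have hS : IsPreconnected {z : UnitIco | |(z : ℝ) - y| < r} := by
      apply isPreconnected_unitIco
      have : (Subtype.val '' {z : UnitIco | |(z : ℝ) - y| < r} : Set ℝ) =
          Ico 0 1 ∩ Ioo ((y : ℝ) - r) (y + r) := by
        ext x
        constructor
        · rintro ⟨w, hw, rfl⟩
          obtain ⟨h1, h2⟩ := abs_lt.1 (show |(w : ℝ) - y| < r from hw)
          exact ⟨w.2, by linarith, by linarith⟩
        · rintro ⟨hx, h1, h2⟩
          exact ⟨⟨x, hx⟩, show |x - y| < r from abs_lt.2 ⟨by linarith, by linarith⟩, rfl⟩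
      rw [this]
      exact ordConnected_Ico.inter ordConnected_Ioo
    obtain ⟨s, hs⟩ := hT.exists_translation hdisc k hS (by
      intro w hw i hi hmem
      have e := ih i hi (by lia) hw
      have := hr i (by lia) _ hmem
      rw [e, show ((T^[i] y : UnitIco) : ℝ) - (w + ((T^[i] y : UnitIco) - y)) = -(w - y) by ring,
        abs_neg] at this
      exact absurd hw (not_lt.2 this))
    rw [hs z hz, hs y (show |(y : ℝ) - y| < r by simpa using hr0)]
    ring

theorem ae_real_of_ae_lebesgueIco {P : UnitIco → Prop} (h : ∀ᵐ x ∂lebesgueIco, P x) :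
    ∀ᵐ z : ℝ, ∀ hz : z ∈ Ico (0 : ℝ) 1, P ⟨z, hz⟩ := by
  rw [ae_iff, lebesgueIco_apply] at h
  rw [ae_iff]
  refine measure_mono_null ?_ h
  intro z hz
  simp only [mem_ofPred_eq, not_forall] at hz
  obtain ⟨hz1, hz2⟩ := hz
  exact ⟨⟨z, hz1⟩, hz2, rfl⟩

theorem lebesgueIco_abs_sub_le (a r : ℝ) :
    lebesgueIco {z | |(z : ℝ) - a| ≤ r} ≤ ENNReal.ofReal (2 * r) := by
  rw [lebesgueIco_apply]
  refine (measure_mono ?_).trans (Real.volume_closedBall a r).le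
  rintro _ ⟨z, hz, rfl⟩
  exact hz

theorem iterate_transfer {T : Equiv.Perm UnitIco} (hT : IsIET T) {f : ℝ → ℝ} {θ : ℝ}
    {h : UnitIco → ℂ}
    (hrel : ∀ᵐ x ∂lebesgueIco, h (T x) = Complex.exp (Complex.I * θ * f x) * h x) (N : ℕ) :
    ∀ᵐ x ∂lebesgueIco, h (T^[N] x) =
      Complex.exp (Complex.I * θ * ((∑ i ∈ Finset.range N, f (T^[i] x) : ℝ) : ℂ)) * h x := by
  induction N with
  | zero => simp
  | succ N ih =>
    filter_upwards [ih, (hT.measurePreserving.iterate N).quasiMeasurePreserving.ae hrel]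
      with x h1 h2
    rw [Function.iterate_succ_apply', h2, h1, ← mul_assoc, ← Complex.exp_add,
      Finset.sum_range_succ]
    congr 2
    push_cast
    ring

set_option maxHeartbeats 1000000 in
/-- There is no unimodular measurable solution of the eigenvalue equation of large frequency. -/
theorem no_transfer_function {T : Equiv.Perm UnitIco} (hT : IsIET T) (hE : Ergodic T lebesgueIco)
    {f : ℝ → ℝ} {A : Set ℝ} (hAfin : A.Finite)
    (hf_C2 : ContDiffOn ℝ 2 f (Set.Ioo (0 : ℝ) 1 \ A))
    (hdisc : ∀ x : UnitIco, ¬ ContinuousAt T x → (x : ℝ) ∈ A) (hgrowth : AtLeastLogGrowth f A) :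
    ∃ s₀ : ℝ, ∀ θ : ℝ, s₀ ≤ |θ| → ∀ h : UnitIco → ℂ, Measurable h → (∀ x, ‖h x‖ = 1) →
      (∀ᵐ x ∂lebesgueIco, h (T x) = Complex.exp (Complex.I * θ * f x) * h x) → False := by
  obtain ⟨B, C, hB, hC, hgr⟩ := hgrowth
  obtain ⟨ρ, hρ, hhit⟩ := exists_frequent_hits hT hE hAfin hdisc
  -- Avoiding $0$ and $1$ as well keeps the translated balls inside $(0,1)$.
  set A₁ : Set ℝ := A ∪ {0, 1} with hA₁def
  have hA₁ : A₁.Finite := hAfin.union (by simp)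
  set K : ℝ := (hA₁.toFinset.card : ℝ) with hK
  have hK0 : 0 < K := by
    rw [hK, Nat.cast_pos, Finset.card_pos]
    exact ⟨0, by simp [hA₁def]⟩
  -- The points that come within $4\eta/(m+1)$ of $A_1$ at one of the $m+1$ times have measure at
  -- most $8K\eta\le\rho/4$.
  set η : ℝ := min 1 (ρ / (32 * K)) with hη
  have hη0 : 0 < η := lt_min one_pos (by positivity)
  have hη1 : η ≤ 1 := min_le_left _ _
  have hηK : 8 * K * η ≤ ρ / 4 := by
    have : η ≤ ρ / (32 * K) := min_le_right _ _
    rw [le_div_iff₀ (by positivity)] at this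
    linarith
  refine ⟨2048 / (C * η ^ 2), fun θ hθ h hm hnorm hrel => ?_⟩
  have hθ0 : 0 < |θ| := lt_of_lt_of_le (by positivity) hθ
  have hθC : 2048 ≤ |θ| * (C * η ^ 2) := by rwa [div_le_iff₀ (by positivity)] at hθ
  set H : ℝ → ℂ := Function.extend Subtype.val h 0 with hHdef
  have hHv : ∀ x : UnitIco, H x = h x := fun x => Subtype.val_injective.extend_apply _ _ _
  have hHm : Measurable H := measurableEmbedding_coe_unitIco.measurable_extend hm measurable_zero
  have hHb : ∀ x, ‖H x‖ ≤ 1 := by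
    intro x
    by_cases hx : x ∈ Ico (0 : ℝ) 1
    · exact ((congrArg norm (hHv ⟨x, hx⟩)).trans (hnorm _)).le
    · rw [hHdef, Function.extend_apply' _ _ _ (by rintro ⟨z, rfl⟩; exact hx z.2)]
      simp
  set r : ℕ → ℝ := fun m => 4 * η / (m + 1) with hrdef
  have hr0 : ∀ m, 0 < r m := fun m => by positivity
  have hrlim : Tendsto r atTop (𝓝 0) :=
    tendsto_const_nhds.div_atTop (tendsto_atTop_add_const_right _ _ tendsto_natCast_atTop_atTop)
  set Bad : ℕ → Set UnitIco := fun m => {x : UnitIco |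
      1 / 16 * r m ≤ ∫ t in (-r m)..(r m), ‖H (x + t) - H x‖} with hBad
  have hBadlim := tendsto_measure_oscillation hHm hHb hr0 hrlim (κ := 1 / 16) (by norm_num)
  have hev : ∀ᶠ m : ℕ in atTop, lebesgueIco (Bad m) < ENNReal.ofReal (ρ / 4) ∧
      (1 : ℝ) ≤ m ∧ 256 * B / C ≤ (m : ℝ) :=
    (hBadlim.eventually_lt_const (by simpa using hρ)).and
      ((tendsto_natCast_atTop_atTop.eventually_ge_atTop (1 : ℝ)).and
        (tendsto_natCast_atTop_atTop.eventually_ge_atTop (256 * B / C)))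
  obtain ⟨M, hM⟩ := eventually_atTop.1 hev
  obtain ⟨m, hmM, hmρ⟩ := hhit M
  obtain ⟨hbad, hm1, hmB⟩ := hM m hmM
  have hm0 : (0 : ℝ) < m := by linarith
  set V : Set UnitIco := ⋃ i ∈ Finset.range (m + 1), ⋃ a ∈ hA₁.toFinset,
    T^[i] ⁻¹' {z | |(z : ℝ) - a| ≤ r m} with hV
  have hVle : lebesgueIco V ≤ ENNReal.ofReal (ρ / 4) := by
    calc lebesgueIco V ≤ ∑ i ∈ Finset.range (m + 1), ∑ a ∈ hA₁.toFinset,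
          lebesgueIco (T^[i] ⁻¹' {z | |(z : ℝ) - a| ≤ r m}) :=
          (measure_biUnion_finset_le _ _).trans
            (Finset.sum_le_sum fun i _ => measure_biUnion_finset_le _ _)
      _ ≤ ∑ i ∈ Finset.range (m + 1), ∑ a ∈ hA₁.toFinset, ENNReal.ofReal (2 * r m) :=
          Finset.sum_le_sum fun i _ => Finset.sum_le_sum fun a _ =>
            ((hT.measurePreserving.iterate i).measure_preimage_le _).trans
              (lebesgueIco_abs_sub_le a _)
      _ = ENNReal.ofReal (8 * K * η) := by
          rw [Finset.sum_const, Finset.sum_const, Finset.card_range, ← ENNReal.ofReal_nsmul,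
            ← ENNReal.ofReal_nsmul]
          congr 1
          simp only [hrdef, nsmul_eq_mul, ← hK]
          push_cast
          field_simp
          norm_num
      _ ≤ ENNReal.ofReal (ρ / 4) := ENNReal.ofReal_le_ofReal hηK
  -- The three excluded sets have total measure at most $3\rho/4$, less than that of the hitting
  -- set.
  obtain ⟨y, hyhit, hyV⟩ : ∃ y, y ∈ {x : UnitIco | ∃ i ≤ m, ∃ a ∈ A,
      a ≤ (T^[i] x : UnitIco) ∧ ((T^[i] x : UnitIco) : ℝ) ≤ a + 4 / m} ∧
      y ∉ V ∪ (Bad m ∪ T^[m + 1] ⁻¹' (Bad m)) := by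
    by_contra! hcon
    have h1 : ENNReal.ofReal ρ < ENNReal.ofReal ρ := by
      calc ENNReal.ofReal ρ ≤ _ := hmρ
        _ ≤ lebesgueIco (V ∪ (Bad m ∪ T^[m + 1] ⁻¹' (Bad m))) := measure_mono hcon
        _ ≤ lebesgueIco V + (lebesgueIco (Bad m) + lebesgueIco (T^[m + 1] ⁻¹' (Bad m))) :=
            (measure_union_le _ _).trans (by gcongr; exact measure_union_le _ _)
        _ ≤ ENNReal.ofReal (ρ / 4) + (ENNReal.ofReal (ρ / 4) + ENNReal.ofReal (ρ / 4)) := by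
            gcongr
            exact ((hT.measurePreserving.iterate _).measure_preimage_le _).trans hbad.le
        _ = ENNReal.ofReal (ρ / 4 + (ρ / 4 + ρ / 4)) := by
            rw [ENNReal.ofReal_add (by positivity) (by positivity),
              ENNReal.ofReal_add (by positivity) (by positivity)]
        _ < ENNReal.ofReal ρ := (ENNReal.ofReal_lt_ofReal_iff hρ).2 (by linarith)
    exact lt_irrefl _ h1
  simp only [mem_union, not_or] at hyV
  obtain ⟨hyV, hyB1, hyB2⟩ := hyV
  simp only [hBad, mem_preimage, mem_ofPred_eq, not_le] at hyB1 hyB2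
  have havoid : ∀ i < m + 1, ∀ a ∈ A₁, r m < |((T^[i] y : UnitIco) : ℝ) - a| := by
    intro i hi a ha
    by_contra! hle
    exact hyV (mem_biUnion (Finset.mem_coe.2 (Finset.mem_range.2 hi))
      (mem_biUnion (Finset.mem_coe.2 (hA₁.mem_toFinset.2 ha)) hle))
  set R := r m with hR
  have hR0 : 0 < R := hr0 m
  have hR4 : R ≤ 4 / m := by
    rw [hR, hrdef]
    dsimp only
    gcongr
    · linarith
    · linarith
  set c : ℕ → ℝ := fun i => ((T^[i] y : UnitIco) : ℝ) - y with hcdef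
  set O : Set ℝ := Ioo (0 : ℝ) 1 \ A with hO
  have hOopen : IsOpen O := isOpen_Ioo.sdiff hAfin.isClosed
  have hmemO : ∀ i < m + 1, ∀ z ∈ Ioo ((y : ℝ) - R) (y + R), z + c i ∈ O := by
    intro i hi z hz
    have h0 := havoid i hi 0 (by simp [hA₁def])
    have h1 := havoid i hi 1 (by simp [hA₁def])
    have h2 := (T^[i] y).2
    rw [sub_zero, abs_of_nonneg h2.1] at h0
    rw [abs_of_neg (by linarith [h2.2])] at h1
    have e : z + c i = (T^[i] y : UnitIco) + (z - y) := by simp only [hcdef]; ring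
    refine ⟨⟨by rw [e]; linarith [hz.1], by rw [e]; linarith [hz.2]⟩, fun hA => ?_⟩
    have h3 := havoid i hi _ (Or.inl hA)
    rw [e, show ((T^[i] y : UnitIco) : ℝ) - ((T^[i] y : UnitIco) + (z - y)) = y - z by ring] at h3
    exact absurd h3 (not_lt.2 (abs_le.2 ⟨by linarith [hz.2], by linarith [hz.1]⟩))
  have hzIco : ∀ z ∈ Ioo ((y : ℝ) - R) (y + R), z ∈ Ico (0 : ℝ) 1 := by
    intro z hz
    have := (hmemO 0 (by lia) z hz).1
    simp only [hcdef, Function.iterate_zero, id, sub_self, add_zero] at this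
    exact ⟨this.1.le, this.2⟩
  have hdf1 : ∀ x ∈ O, HasDerivAt f (deriv f x) x := fun x hx =>
    ((hf_C2.differentiableOn (by norm_num)).differentiableAt (hOopen.mem_nhds hx)).hasDerivAt
  have hC1 : ContDiffOn ℝ 1 (deriv f) O := hf_C2.deriv_of_isOpen hOopen (by norm_num)
  have hdf2 : ∀ x ∈ O, HasDerivAt (deriv f) (deriv (deriv f) x) x := fun x hx =>
    ((hC1.differentiableOn (by norm_num)).differentiableAt (hOopen.mem_nhds hx)).hasDerivAt
  have hcf2 : ContinuousOn (deriv (deriv f)) O := hC1.continuousOn_deriv_of_isOpen hOopen le_rfl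
  set F : ℝ → ℝ := fun z => ∑ i ∈ Finset.range (m + 1), f (z + c i) with hFdef
  set F' : ℝ → ℝ := fun z => ∑ i ∈ Finset.range (m + 1), deriv f (z + c i) with hF'def
  set F'' : ℝ → ℝ := fun z => ∑ i ∈ Finset.range (m + 1), deriv (deriv f) (z + c i) with hF''def
  have hF1 : ∀ z ∈ Ioo ((y : ℝ) - R) (y + R), HasDerivAt F (F' z) z := fun z hz =>
    HasDerivAt.fun_sum fun i hi =>
      (hdf1 _ (hmemO i (Finset.mem_range.1 hi) z hz)).comp_add_const z (c i)
  have hF2 : ∀ z ∈ Ioo ((y : ℝ) - R) (y + R), HasDerivAt F' (F'' z) z := fun z hz =>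
    HasDerivAt.fun_sum fun i hi =>
      (hdf2 _ (hmemO i (Finset.mem_range.1 hi) z hz)).comp_add_const z (c i)
  have hF3 : ContinuousOn F'' (Ioo ((y : ℝ) - R) (y + R)) :=
    continuousOn_finsetSum _ fun i hi =>
      hcf2.comp (continuousOn_id.add continuousOn_const) (hmemO i (Finset.mem_range.1 hi))
  have hlow : ∀ z ∈ Ioo ((y : ℝ) - R) (y + R), C * m ^ 2 / 128 ≤ F'' z := by
    intro z hz
    obtain ⟨j, hj, a, ha, ha1, ha2⟩ := hyhit
    have hjm : j ∈ Finset.range (m + 1) := Finset.mem_range.2 (by lia)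
    have hpt : C * m ^ 2 / 64 - B ≤ deriv (deriv f) (z + c j) := by
      refine le_trans ?_ (hgr _ (hmemO j (by lia) z hz))
      have hd0 : 0 < Metric.infDist (z + c j) A :=
        (hAfin.isClosed.notMem_iff_infDist_pos ⟨a, ha⟩).1 (hmemO j (by lia) z hz).2
      have hd : Metric.infDist (z + c j) A ≤ 8 / m := by
        refine (Metric.infDist_le_dist_of_mem ha).trans ?_
        have e : z + c j - a = ((T^[j] y : UnitIco) - a) + (z - y) := by simp only [hcdef]; ring
        have e2 : (8 : ℝ) / m = 4 / m + 4 / m := by ring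
        rw [Real.dist_eq, e, e2, abs_le]
        constructor <;> linarith [hz.1, hz.2]
      have : C * m ^ 2 / 64 = C / (8 / m) ^ 2 := by field_simp; norm_num
      rw [this]
      gcongr
    have hothers : ∀ i ∈ (Finset.range (m + 1)).erase j, -B ≤ deriv (deriv f) (z + c i) := by
      intro i hi
      refine le_trans ?_ (hgr _ (hmemO i (Finset.mem_range.1 (Finset.mem_of_mem_erase hi)) z hz))
      have : 0 ≤ C / Metric.infDist (z + c i) A ^ 2 := by positivity
      linarith
    have hsum : ((m + 1 - 1 : ℕ) : ℝ) * -B ≤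
        ∑ i ∈ (Finset.range (m + 1)).erase j, deriv (deriv f) (z + c i) := by
      have := Finset.card_nsmul_le_sum _ _ _ hothers
      rwa [Finset.card_erase_of_mem hjm, Finset.card_range, nsmul_eq_mul] at this
    rw [hF''def]
    dsimp only
    rw [← Finset.add_sum_erase _ _ hjm]
    -- Together with $m\ge1$ this gives $(m+1)B\le Cm^2/128$, so the losses use up at most half of
    -- the main term $Cm^2/64$.
    have hmB' : 256 * B ≤ C * m := by rw [div_le_iff₀ hC] at hmB; linarith
    simp only [Nat.add_sub_cancel] at hsum
    nlinarith
  have hθne : θ ≠ 0 := abs_pos.1 hθ0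
  obtain ⟨a, b, hya, hby, hba, hosc⟩ := exists_small_oscillatory_integral hR0
    (by positivity : 0 < C * (m : ℝ) ^ 2 / 128) hF1 hF2 hF3 hlow hθne
  have hshift : ∀ z ∈ Ioo ((y : ℝ) - R) (y + R), ∀ hz' : z ∈ Ico (0 : ℝ) 1, ∀ i ≤ m + 1,
      ((T^[i] (⟨z, hz'⟩ : UnitIco) : UnitIco) : ℝ) = z + c i := by
    intro z hz hz' i hi
    exact hT.translation_on_ball hdisc hR0 (fun i hi a ha => (havoid i hi a (Or.inl ha)).le) hi
      (abs_lt.2 ⟨by linarith [hz.1], by linarith [hz.2]⟩)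
  have hrelz : ∀ᵐ z : ℝ, z ∈ Ioo ((y : ℝ) - R) (y + R) →
      H (z + c (m + 1)) = Complex.exp (Complex.I * θ * F z) * H z := by
    filter_upwards [ae_real_of_ae_lebesgueIco (iterate_transfer hT hrel (m + 1))] with z hz hzI
    have hz' := hzIco z hzI
    have e := hz hz'
    rw [← hshift z hzI hz' (m + 1) le_rfl, hHv, e]
    have e1 : H z = h ⟨z, hz'⟩ := hHv ⟨z, hz'⟩
    have e2 : ∑ i ∈ Finset.range (m + 1), f (T^[i] (⟨z, hz'⟩ : UnitIco) : UnitIco) = F z :=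
      Finset.sum_congr rfl fun i hi => by
        rw [hshift z hzI hz' i (Finset.mem_range.1 hi).le]
    rw [e1, e2]
  have hcy : (y : ℝ) + c (m + 1) = (T^[m + 1] y : UnitIco) := by simp only [hcdef]; ring
  have hE1 : ∀ x, ‖Complex.exp (Complex.I * θ * F x)‖ = 1 := by
    intro x
    have : Complex.I * θ * F x = ((θ * F x : ℝ) : ℂ) * Complex.I := by push_cast; ring
    rw [this, Complex.norm_exp_ofReal_mul_I]
  have hFc : ContinuousOn (fun x => Complex.exp (Complex.I * θ * F x)) (Icc a b) := by
    refine (continuousOn_const.mul (Complex.continuous_ofReal.comp_continuousOn ?_)).cexp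
    exact fun x hx =>
      (hF1 x ⟨by linarith [hx.1], by linarith [hx.2]⟩).continuousAt.continuousWithinAt
  have hfinal := length_le_of_almost_constant hHm hHb hya (by linarith) hby hFc hE1 hrelz
    hyB1.le (by rw [hcy]; exact hyB2.le)
  rw [hcy, hHv, hnorm, hba, mul_one] at hfinal
  -- Since $Rm\ge2\eta$, this is what the threshold $2048/(C\eta^2)$ on $|\theta|$ is for. The
  -- contradiction is then $R/4\le R/16+2R/16$.
  have hlast : 4 / (|θ| * (C * m ^ 2 / 128) * R) ≤ R / 16 := by
    rw [div_le_iff₀ (by positivity)]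
    have e : R * (m + 1) = 4 * η := div_mul_cancel₀ _ (by positivity)
    have e2 : 2 * η ≤ R * m := by nlinarith
    have e3 : (2 * η) ^ 2 ≤ (R * m) ^ 2 := by gcongr
    have e4 : R / 16 * (|θ| * (C * m ^ 2 / 128) * R) = |θ| * C * (R * m) ^ 2 / 2048 := by ring
    have e5 : |θ| * C * (2 * η) ^ 2 ≤ |θ| * C * (R * m) ^ 2 := by gcongr
    rw [e4, le_div_iff₀ (by norm_num)]
    nlinarith
  linarith

/-! ### The cocycle over the base and the skew product -/

theorem measurable_roof {f : ℝ → ℝ} {A : Set ℝ} (hAfin : A.Finite)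
    (hf : ContinuousOn f (Set.Ioo (0 : ℝ) 1 \ A)) : Measurable fun x : UnitIco => f x := by
  have hfin : (Subtype.val ⁻¹' (A ∪ {0}) : Set UnitIco).Finite :=
    (hAfin.union (finite_singleton 0)).preimage Subtype.val_injective.injOn
  refine measurable_of_measurable_on_compl_finite _ hfin (Continuous.measurable ?_)
  refine hf.comp_continuous (continuous_subtype_val.comp continuous_subtype_val) ?_
  rintro ⟨x, hx⟩
  simp only [mem_compl_iff, mem_preimage, mem_union, mem_singleton_iff, not_or] at hx
  exact ⟨⟨lt_of_le_of_ne x.2.1 (Ne.symm hx.2), x.2.2⟩, hx.1⟩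

theorem IsIET.measurePreserving_zpow {T : Equiv.Perm UnitIco} (hT : IsIET T) (k : ℤ) :
    MeasurePreserving (T ^ k : Equiv.Perm UnitIco) lebesgueIco lebesgueIco := by
  have : StandardBorelSpace UnitIco := measurableSet_Ico.standardBorel
  have hemb : MeasurableEmbedding T := hT.measurable.measurableEmbedding T.injective
  have hsymm : Measurable T.symm := by
    intro S hS
    rw [← T.image_eq_preimage_symm]
    exact hemb.measurableSet_image.2 hS
  let e : UnitIco ≃ᵐ UnitIco := ⟨T, hT.measurable, hsymm⟩
  have hinv : MeasurePreserving T.symm lebesgueIco lebesgueIco :=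
    MeasurePreserving.symm e hT.measurePreserving
  cases k with
  | ofNat n =>
    have := hT.measurePreserving.iterate n
    rwa [Equiv.Perm.iterate_eq_pow] at this
  | negSucc n =>
    have := hinv.iterate (n + 1)
    rw [Int.negSucc_eq, zpow_neg, ← inv_zpow]
    rwa [← Equiv.Perm.inv_def, Equiv.Perm.iterate_eq_pow] at this

theorem IsIET.ae_orbit_avoids {T : Equiv.Perm UnitIco} (hT : IsIET T) {A : Set ℝ}
    (hA : A.Finite) : ∀ᵐ x ∂lebesgueIco, ∀ k : ℤ, (((T ^ k) x : UnitIco) : ℝ) ∉ A := by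
  have h0 : ∀ᵐ x : UnitIco ∂lebesgueIco, (x : ℝ) ∉ A := by
    rw [ae_iff, lebesgueIco_apply]
    refine measure_mono_null ?_ (hA.measure_zero volume)
    rintro _ ⟨x, hx, rfl⟩
    exact not_not.1 hx
  exact ae_all_iff.2 fun k => (hT.measurePreserving_zpow k).quasiMeasurePreserving.ae h0

section Cocycle

variable (T : Equiv.Perm UnitIco) (f : ℝ → ℝ)

theorem cocycleSum_zero (x : UnitIco) : cocycleSum T f 0 x = 0 := by
  simp [cocycleSum]

theorem cocycleSum_add (m n : ℤ) (x : UnitIco) :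
    cocycleSum T f (m + n) x = cocycleSum T f m x + cocycleSum T f n ((T ^ m) x) := by
  have hpow : ∀ n : ℤ, (T ^ n) ((T ^ m) x) = (T ^ (m + n)) x := by
    intro n
    rw [← Equiv.Perm.mul_apply, ← zpow_add, add_comm]
  induction n using Int.induction_on with
  | zero => simp [cocycleSum_zero]
  | succ n ih =>
    rw [← add_assoc, cocycleSum_add_one, cocycleSum_add_one, ih, hpow]
    ring
  | pred n ih =>
    have h1 := cocycleSum_add_one T f (m + (-n - 1)) x
    have h2 := cocycleSum_add_one T f (-n - 1) ((T ^ m) x)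
    rw [show m + (-(n : ℤ) - 1) + 1 = m + -n by ring, ih] at h1
    rw [show -(n : ℤ) - 1 + 1 = -n by ring, hpow] at h2
    linarith

theorem cocycleSum_monotone {x : UnitIco} (hx : ∀ k : ℤ, 0 ≤ f ((T ^ k) x)) :
    Monotone fun n : ℤ => cocycleSum T f n x :=
  monotone_int_of_le_succ fun n => by rw [cocycleSum_add_one]; linarith [hx n]

theorem index_unique {x : UnitIco} (hx : ∀ k : ℤ, 0 ≤ f ((T ^ k) x)) {m n : ℤ} {v : ℝ}
    (h1 : cocycleSum T f m x ≤ v) (h2 : v < cocycleSum T f (m + 1) x)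
    (h3 : cocycleSum T f n x ≤ v) (h4 : v < cocycleSum T f (n + 1) x) : m = n := by
  have hmono := cocycleSum_monotone T f hx
  rcases lt_trichotomy m n with h | h | h
  · linarith [hmono (show m + 1 ≤ n by lia)]
  · exact h
  · linarith [hmono (show n + 1 ≤ m by lia)]

/-- The map `(x, u) ↦ (T ^ n x, u - S_n x)` of the cylinder `[0,1) × ℝ`. -/
noncomputable def skewPow (n : ℤ) (p : UnitIco × ℝ) : UnitIco × ℝ :=
  ((T ^ n) p.1, p.2 - cocycleSum T f n p.1)

theorem specialFlow_coe {z : SpecialFlowSpace f} (hx : ∀ k : ℤ, 0 ≤ f ((T ^ k) z.1.1)) {n : ℤ}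
    {t : ℝ} (h1 : cocycleSum T f n z.1.1 ≤ z.1.2 + t)
    (h2 : z.1.2 + t < cocycleSum T f (n + 1) z.1.1) :
    (specialFlow T f t z).1 = skewPow T f n (z.1.1, z.1.2 + t) := by
  have h : ∃ n : ℤ, cocycleSum T f n z.1.1 ≤ z.1.2 + t ∧
      z.1.2 + t < cocycleSum T f (n + 1) z.1.1 := ⟨n, h1, h2⟩
  have hn : h.choose = n := index_unique T f hx h.choose_spec.1 h.choose_spec.2 h1 h2
  rw [specialFlow, dif_pos h]
  exact congrArg (fun k => skewPow T f k (z.1.1, z.1.2 + t)) hn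

variable {T f}

theorem measurable_cocycleSum (hT : IsIET T) (hf : Measurable fun x : UnitIco => f x) (n : ℤ) :
    Measurable (cocycleSum T f n) := by
  unfold cocycleSum
  exact (Finset.measurable_sum _ fun k _ => hf.comp (hT.measurePreserving_zpow k).measurable).sub
    (Finset.measurable_sum _ fun k _ => hf.comp (hT.measurePreserving_zpow k).measurable)

theorem measurePreserving_skewPow (hT : IsIET T) (hf : Measurable fun x : UnitIco => f x) (n : ℤ) :
    MeasurePreserving (skewPow T f n) (lebesgueIco.prod volume) (lebesgueIco.prod volume) := by
  refine (hT.measurePreserving_zpow n).skew_product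
    (g := fun x u => u - cocycleSum T f n x) ?_ ?_
  · exact measurable_snd.sub ((measurable_cocycleSum hT hf n).comp measurable_fst)
  · exact Eventually.of_forall fun x => (measurePreserving_sub_right volume _).map_eq

theorem measurableSet_specialFlowSpace (hf : Measurable fun x : UnitIco => f x) :
    MeasurableSet {p : UnitIco × ℝ | 0 ≤ p.2 ∧ p.2 < f p.1} :=
  (measurableSet_le measurable_const measurable_snd).inter
    (measurableSet_lt measurable_snd (hf.comp measurable_fst))

theorem specialFlowMeasure_apply (hf : Measurable fun x : UnitIco => f x)
    (s : Set (SpecialFlowSpace f)) :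
    specialFlowMeasure f s = lebesgueIco.prod volume (Subtype.val '' s) :=
  (MeasurableEmbedding.subtype_coe (measurableSet_specialFlowSpace hf)).comap_apply _ _

end Cocycle

/-! ### Divergence of Birkhoff sums and unrolling of eigenfunctions -/

theorem exists_positive_level {f : ℝ → ℝ} {A : Set ℝ} (hAfin : A.Finite)
    (hf_nonneg : ∀ x ∈ Set.Ico (0 : ℝ) 1 \ A, 0 ≤ f x)
    (hf_ne : ∃ x ∈ Set.Ioo (0 : ℝ) 1 \ A, f x ≠ 0)
    (hf : ContinuousOn f (Set.Ioo (0 : ℝ) 1 \ A)) :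
    ∃ δ > 0, lebesgueIco {x : UnitIco | δ < f x} ≠ 0 := by
  obtain ⟨x, hx, hx0⟩ := hf_ne
  have hpos : 0 < f x := lt_of_le_of_ne (hf_nonneg x ⟨Ioo_subset_Ico_self hx.1, hx.2⟩) hx0.symm
  have hO : IsOpen (Ioo (0 : ℝ) 1 \ A) := isOpen_Ioo.sdiff hAfin.isClosed
  have hop : IsOpen ((Ioo (0 : ℝ) 1 \ A) ∩ f ⁻¹' Ioi (f x / 2)) :=
    hf.isOpen_inter_preimage hO isOpen_Ioi
  refine ⟨f x / 2, by linarith, ?_⟩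
  rw [lebesgueIco_apply]
  refine ((hop.measure_pos volume ⟨x, hx, show f x / 2 < f x by linarith⟩).trans_le
    (measure_mono ?_)).ne'
  rintro y ⟨hy, hy'⟩
  exact ⟨⟨y, Ioo_subset_Ico_self hy.1⟩, hy', rfl⟩

/-- The set of points visiting $P$ infinitely often is forward invariant and, by Poincaré
recurrence, contains almost all of $P$; ergodicity makes it of full measure. -/
theorem Ergodic.ae_frequently_mem {T : UnitIco → UnitIco} (hE : Ergodic T lebesgueIco)
    {P : Set UnitIco} (hP : MeasurableSet P) (hP0 : lebesgueIco P ≠ 0) :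
    ∀ᵐ x ∂lebesgueIco, ∃ᶠ n in atTop, T^[n] x ∈ P := by
  set L : Set UnitIco := ⋂ N : ℕ, ⋃ n : ℕ, ⋃ _ : N ≤ n, T^[n] ⁻¹' P with hL
  have hmem : ∀ x, x ∈ L ↔ ∃ᶠ n in atTop, T^[n] x ∈ P := by
    intro x
    simp only [hL, mem_iInter, mem_iUnion, exists_prop, mem_preimage, frequently_atTop]
  have hm : MeasurableSet L := MeasurableSet.iInter fun N => MeasurableSet.iUnion fun n =>
    MeasurableSet.iUnion fun _ => (hE.measurable.iterate n) hP
  have hinv : ∀ x ∈ L, T x ∈ L := by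
    intro x hx
    rw [hmem, frequently_atTop] at hx ⊢
    intro N
    obtain ⟨n, hn, hx⟩ := hx (N + 1)
    refine ⟨n - 1, by lia, ?_⟩
    rwa [← Function.iterate_succ_apply, Nat.succ_eq_add_one, Nat.sub_add_cancel (by lia)]
  have hL0 : lebesgueIco L ≠ 0 := by
    intro h0
    apply hP0
    have := hE.toMeasurePreserving.conservative.ae_mem_imp_frequently_image_mem
      hP.nullMeasurableSet
    refine measure_mono_null_ae ?_ h0
    filter_upwards [this] with x hx hxP
    exact (hmem x).2 (hx hxP)
  have := hE.measure_compl_eq_zero_of_forward_invariant hm hinv hL0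
  filter_upwards [show ∀ᵐ x ∂lebesgueIco, x ∈ L from this] with x hx
  exact (hmem x).1 hx

theorem ae_cocycleSum_unbounded {T : Equiv.Perm UnitIco} (hT : IsIET T)
    (hE : Ergodic T lebesgueIco) {f : ℝ → ℝ} {A : Set ℝ} (hAfin : A.Finite)
    (hf_nonneg : ∀ x ∈ Set.Ico (0 : ℝ) 1 \ A, 0 ≤ f x)
    (hf_ne : ∃ x ∈ Set.Ioo (0 : ℝ) 1 \ A, f x ≠ 0)
    (hf : ContinuousOn f (Set.Ioo (0 : ℝ) 1 \ A)) :
    ∀ᵐ x ∂lebesgueIco, (∀ k : ℤ, 0 ≤ f ((T ^ k) x)) ∧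
      ∀ c : ℝ, ∃ n : ℕ, c < cocycleSum T f n x := by
  obtain ⟨δ, hδ, hP⟩ := exists_positive_level hAfin hf_nonneg hf_ne hf
  have hPm : MeasurableSet {x : UnitIco | δ < f x} :=
    measurableSet_lt measurable_const (measurable_roof hAfin hf)
  filter_upwards [hE.ae_frequently_mem hPm hP, hT.ae_orbit_avoids hAfin] with x hx hxA
  have hnn : ∀ k : ℤ, 0 ≤ f ((T ^ k) x) := fun k => hf_nonneg _ ⟨((T ^ k) x).2, hxA k⟩
  refine ⟨hnn, fun c => ?_⟩
  have key : ∀ j : ℕ, ∃ n : ℕ, j * δ ≤ cocycleSum T f n x := by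
    intro j
    induction j with
    | zero => exact ⟨0, by simp [cocycleSum_zero]⟩
    | succ j ih =>
      obtain ⟨n, hn⟩ := ih
      obtain ⟨m, hm, hmP⟩ := frequently_atTop.1 hx n
      refine ⟨m + 1, ?_⟩
      rw [Nat.cast_succ (R := ℤ), cocycleSum_add_one, zpow_natCast, ← Equiv.Perm.iterate_eq_pow]
      have h1 := cocycleSum_monotone T f hnn (show (n : ℤ) ≤ m by exact_mod_cast hm)
      have h2 : δ < f (T^[m] x) := hmP
      push_cast
      simp only at h1
      linarith
  obtain ⟨j, hj⟩ := exists_nat_gt (c / δ)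
  obtain ⟨n, hn⟩ := key j
  rw [div_lt_iff₀ hδ] at hj
  exact ⟨n, hj.trans_le hn⟩

section Unroll

variable (T : Equiv.Perm UnitIco) (f : ℝ → ℝ)

/-- The points whose orbit sees only nonnegative values of the roof, with divergent sum. -/
def RegularPoint (x : UnitIco) : Prop :=
  (∀ k : ℤ, 0 ≤ f ((T ^ k) x)) ∧ ∀ c : ℝ, ∃ n : ℕ, c < cocycleSum T f n x

variable {T f}

theorem RegularPoint.image {x : UnitIco} (hx : RegularPoint T f x) : RegularPoint T f (T x) := by
  constructor
  · intro k
    have := hx.1 (k + 1)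
    rwa [zpow_add_one, Equiv.Perm.mul_apply] at this
  · intro c
    obtain ⟨n, hn⟩ := hx.2 (c + f x)
    refine ⟨n, ?_⟩
    have h1 := cocycleSum_add T f 1 n x
    have h2 := cocycleSum_add_one T f 0 x
    have h3 := cocycleSum_monotone T f hx.1 (show (n : ℤ) ≤ 1 + n by lia)
    simp only [cocycleSum_zero, zero_add, zpow_zero, Equiv.Perm.one_apply, zpow_one] at h1 h2 h3
    linarith

theorem RegularPoint.exists_index {x : UnitIco} (hx : RegularPoint T f x) {u : ℝ} (hu : 0 ≤ u) :
    ∃ n : ℕ, cocycleSum T f n x ≤ u ∧ u < cocycleSum T f (n + 1) x := by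
  classical
  have hex : ∃ n : ℕ, u < cocycleSum T f (n + 1) x := by
    obtain ⟨n, hn⟩ := hx.2 u
    exact ⟨n, hn.trans_le (cocycleSum_monotone T f hx.1 (by lia))⟩
  refine ⟨Nat.find hex, ?_, Nat.find_spec hex⟩
  rcases h : Nat.find hex with _ | n
  · simpa [cocycleSum_zero] using hu
  · have := Nat.find_min hex (m := n) (by lia)
    rw [not_lt] at this
    exact_mod_cast this

/-- A function on the phase space, unrolled along the forward orbits to `[0,1) × [0,∞)`. -/
theorem exists_unrolled_function (hT : IsIET T) (hf : Measurable fun x : UnitIco => f x)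
    {g : SpecialFlowSpace f → ℂ} (hg : Measurable g) :
    ∃ G : UnitIco × ℝ → ℂ, Measurable G ∧ ∀ x, RegularPoint T f x → ∀ u : ℝ, ∀ n : ℕ,
      cocycleSum T f n x ≤ u → u < cocycleSum T f (n + 1) x →
      ∀ z : SpecialFlowSpace f, z.1 = skewPow T f n (x, u) → G (x, u) = g z := by
  classical
  set g' : UnitIco × ℝ → ℂ := Function.extend Subtype.val g 0 with hg'
  have hg'm : Measurable g' :=
    (MeasurableEmbedding.subtype_coe (measurableSet_specialFlowSpace hf)).measurable_extend hg
      measurable_zero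
  -- The second alternative only serves to make the search for the index total; it does not occur
  -- over regular points.
  let p : UnitIco × ℝ → ℕ → Prop := fun q n =>
    q.2 < cocycleSum T f (n + 1) q.1 ∨ ∀ k : ℕ, cocycleSum T f (k + 1) q.1 ≤ q.2
  have hp : ∀ q, ∃ n, p q n := by
    intro q
    by_cases h : ∃ n : ℕ, q.2 < cocycleSum T f (n + 1) q.1
    · obtain ⟨n, hn⟩ := h
      exact ⟨n, Or.inl hn⟩
    · push Not at h
      exact ⟨0, Or.inr h⟩
  have hS : ∀ n : ℤ, Measurable fun q : UnitIco × ℝ => cocycleSum T f n q.1 := fun n =>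
    (measurable_cocycleSum hT hf n).comp measurable_fst
  have hpm : ∀ n, MeasurableSet {q | p q n} := by
    intro n
    refine (measurableSet_lt measurable_snd (hS (n + 1))).union ?_
    have : {q : UnitIco × ℝ | ∀ k : ℕ, cocycleSum T f (k + 1) q.1 ≤ q.2} =
        ⋂ k : ℕ, {q : UnitIco × ℝ | cocycleSum T f (k + 1) q.1 ≤ q.2} := by
      ext q; simp only [mem_iInter, mem_ofPred_eq]
    have hall : MeasurableSet
        {q : UnitIco × ℝ | ∀ k : ℕ, cocycleSum T f (k + 1) q.1 ≤ q.2} := by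
      rw [this]
      exact MeasurableSet.iInter fun k => measurableSet_le (hS (k + 1)) measurable_snd
    exact hall
  have hN := measurable_find hp hpm
  have hJ : Measurable fun q : (UnitIco × ℝ) × ℕ => g' (skewPow T f q.2 q.1) :=
    measurable_from_prod_countable_left fun n =>
      hg'm.comp (measurePreserving_skewPow hT hf n).measurable
  refine ⟨fun q => g' (skewPow T f (Nat.find (hp q) : ℕ) q),
    hJ.comp (measurable_id.prodMk hN), ?_⟩
  intro x hx u n h1 h2 z hz
  have hfind : ∀ k : ℕ, p (x, u) k ↔ u < cocycleSum T f (k + 1) x := by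
    intro k
    refine ⟨fun h => ?_, Or.inl⟩
    rcases h with h | h
    · exact h
    · exact absurd h2 (not_lt.2 (h n))
  have heq : Nat.find (hp (x, u)) = n := by
    rw [Nat.find_eq_iff]
    refine ⟨(hfind n).2 h2, fun k hk => ?_⟩
    rw [hfind, not_lt]
    exact (cocycleSum_monotone T f hx.1 (by lia)).trans h1
  simp only [heq, ← hz, hg']
  exact Subtype.val_injective.extend_apply _ _ _

theorem RegularPoint.skewPow_mem {x : UnitIco} {u : ℝ} {n : ℕ}
    (h1 : cocycleSum T f n x ≤ u) (h2 : u < cocycleSum T f (n + 1) x) :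
    skewPow T f n (x, u) ∈ {p : UnitIco × ℝ | 0 ≤ p.2 ∧ p.2 < f p.1} := by
  rw [cocycleSum_add_one] at h2
  exact ⟨by simpa [skewPow] using h1, by simp only [skewPow]; linarith⟩

theorem RegularPoint.specialFlow_skewPow {x : UnitIco} (hx : RegularPoint T f x) {u t : ℝ}
    {n m : ℕ} (hm1 : cocycleSum T f m x ≤ u + t) (hm2 : u + t < cocycleSum T f (m + 1) x)
    {z : SpecialFlowSpace f} (hz : z.1 = skewPow T f n (x, u)) :
    (specialFlow T f t z).1 = skewPow T f m (x, u + t) := by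
  have e1 : z.1.1 = (T ^ (n : ℤ)) x := by rw [hz]; rfl
  have e2 : z.1.2 = u - cocycleSum T f n x := by rw [hz]; rfl
  have hadd : ∀ k : ℤ, cocycleSum T f (k - n) z.1.1 = cocycleSum T f k x - cocycleSum T f n x := by
    intro k
    have := cocycleSum_add T f n (k - n) x
    rw [add_sub_cancel] at this
    rw [e1, this]
    ring
  have hpow : ∀ k : ℤ, (T ^ k) z.1.1 = (T ^ (k + n)) x := by
    intro k
    rw [e1, ← Equiv.Perm.mul_apply, ← zpow_add]
  rw [specialFlow_coe T f (n := m - n) (fun k => by rw [hpow]; exact hx.1 _)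
    (by rw [hadd, e2]; linarith)
    (by rw [show (m : ℤ) - n + 1 = (m + 1) - n by ring, hadd, e2]; linarith)]
  simp only [skewPow, hadd, hpow, e2, sub_add_cancel]
  rw [show u - cocycleSum T f n x + t - (cocycleSum T f m x - cocycleSum T f n x) =
    u + t - cocycleSum T f m x by ring]

end Unroll

/-- A measurable eigenfunction of the special flow is of the form `e^{iθu} h(x)`, where `h` solves
the corresponding equation over the base. -/
theorem exists_base_function {T : Equiv.Perm UnitIco} (hT : IsIET T) {f : ℝ → ℝ}
    (hf : Measurable fun x : UnitIco => f x) (hreg : ∀ᵐ x ∂lebesgueIco, RegularPoint T f x)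
    {g : SpecialFlowSpace f → ℂ} (hg : Measurable g) {θ : ℝ}
    (heig : ∀ t : ℝ, ∀ᵐ z ∂specialFlowMeasure f,
      g (specialFlow T f t z) = Complex.exp (Complex.I * θ * t) * g z) :
    ∃ h : UnitIco → ℂ, Measurable h ∧
      (∀ᵐ x ∂lebesgueIco, h (T x) = Complex.exp (Complex.I * θ * f x) * h x) ∧
      ∀ᵐ p ∂lebesgueIco.prod (volume : Measure ℝ), ∀ z : SpecialFlowSpace f, z.1 = p →
        g z = Complex.exp (Complex.I * θ * p.2) * h p.1 := by
  obtain ⟨G, hGm, hG⟩ := exists_unrolled_function hT hf hg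
  have hflow : ∀ t : ℝ, 0 ≤ t → ∀ᵐ p ∂lebesgueIco.prod (volume : Measure ℝ), 0 ≤ p.2 →
      G (p.1, p.2 + t) = Complex.exp (Complex.I * θ * t) * G p := by
    intro t ht
    have h0 := heig t
    rw [ae_iff, specialFlowMeasure_apply hf] at h0
    have h1 : ∀ᵐ p ∂lebesgueIco.prod (volume : Measure ℝ), ∀ n : ℕ,
        skewPow T f n p ∉ Subtype.val '' {z : SpecialFlowSpace f |
          ¬ g (specialFlow T f t z) = Complex.exp (Complex.I * θ * t) * g z} :=
      ae_all_iff.2 fun n =>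
        (measurePreserving_skewPow hT hf n).quasiMeasurePreserving.ae (measure_eq_zero_iff_ae_notMem.1 h0)
    have h2 : ∀ᵐ p ∂lebesgueIco.prod (volume : Measure ℝ), RegularPoint T f p.1 :=
      Measure.quasiMeasurePreserving_fst.ae hreg
    filter_upwards [h1, h2] with p hp hx hu
    obtain ⟨x, u⟩ := p
    obtain ⟨n, hn1, hn2⟩ := hx.exists_index hu
    obtain ⟨m, hm1, hm2⟩ := hx.exists_index (u := u + t) (add_nonneg hu ht)
    let z : SpecialFlowSpace f := ⟨_, RegularPoint.skewPow_mem hn1 hn2⟩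
    have e1 := hG x hx u n hn1 hn2 z rfl
    have e2 := hG x hx (u + t) m hm1 hm2 (specialFlow T f t z)
      (hx.specialFlow_skewPow hm1 hm2 rfl)
    have e3 : g (specialFlow T f t z) = Complex.exp (Complex.I * θ * t) * g z := by
      by_contra hne
      exact hp n ⟨z, hne, rfl⟩
    rw [e2, e3, e1]
  set ψ : UnitIco × ℝ → ℂ := fun p => Complex.exp (-(Complex.I * θ * p.2)) * G p with hψ
  have hψm : Measurable ψ := by
    refine Measurable.mul ?_ hGm
    exact ((Complex.measurable_ofReal.comp measurable_snd).const_mul (Complex.I * θ)).neg.cexp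
  have hGψ : ∀ p : UnitIco × ℝ, G p = Complex.exp (Complex.I * θ * p.2) * ψ p := by
    intro p
    simp only [hψ]
    rw [← mul_assoc, ← Complex.exp_add, add_neg_cancel, Complex.exp_zero, one_mul]
  -- With the factor $e^{i\theta u}$ removed, the function is invariant under upward shifts, for
  -- each $t$ off a null set depending on $t$. Fubini exchanges the order of the quantifiers.
  have hae1 : ∀ᵐ t : ℝ, ∀ᵐ p ∂lebesgueIco.prod (volume : Measure ℝ), 0 ≤ t → 0 ≤ p.2 →
      ψ (p.1, p.2 + t) = ψ p := by
    refine Eventually.of_forall fun t => ?_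
    by_cases ht : 0 ≤ t
    · filter_upwards [hflow t ht] with p hp _ hu
      simp only [hψ]
      rw [hp hu, ← mul_assoc, ← Complex.exp_add]
      congr 2
      push_cast
      ring
    · exact Eventually.of_forall fun p h => absurd h ht
  rw [Measure.ae_ae_comm] at hae1
  swap
  · have : {q : ℝ × UnitIco × ℝ | 0 ≤ q.1 → 0 ≤ q.2.2 → ψ (q.2.1, q.2.2 + q.1) = ψ q.2} =
      {q | 0 ≤ q.1}ᶜ ∪ ({q | 0 ≤ q.2.2}ᶜ ∪ {q | ψ (q.2.1, q.2.2 + q.1) = ψ q.2}) := by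
      ext q
      simp only [mem_ofPred_eq, mem_union, mem_compl_iff]
      tauto
    rw [this]
    have m1 : Measurable fun q : ℝ × UnitIco × ℝ => q.2.2 := measurable_snd.comp measurable_snd
    refine (measurableSet_le measurable_const measurable_fst).compl.union
      ((measurableSet_le measurable_const m1).compl.union (measurableSet_eq_fun ?_ ?_))
    · exact hψm.comp ((measurable_fst.comp measurable_snd).prodMk (m1.add measurable_fst))
    · exact hψm.comp measurable_snd
  have hI := Measure.ae_ae_of_ae_prod hae1
  have hI' := Measure.ae_ae_of_ae_prod
    ((Measure.measurePreserving_swap (μ := (volume : Measure ℝ))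
      (ν := lebesgueIco)).quasiMeasurePreserving.ae hae1)
  obtain ⟨u₀, hu₀, hbase⟩ := Measure.exists_mem_of_measure_ne_zero_of_ae
    (s := Ioo (0 : ℝ) 1) (μ := volume) (by simp) (ae_restrict_of_ae hI')
  -- A generic level $u_0$ defines $h$. Levels above $u_0$ are reached from it by shifting up; a
  -- level below is compared with $u_0$ through a common higher level.
  set h : UnitIco → ℂ := fun x => ψ (x, u₀) with hh
  have hII : ∀ᵐ x ∂lebesgueIco, ∀ᵐ v : ℝ, u₀ ≤ v → ψ (x, v) = h x := by
    filter_upwards [hbase] with x hx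
    have := (measurePreserving_sub_right volume u₀).quasiMeasurePreserving.ae hx
    filter_upwards [this] with v hv huv
    have := hv (sub_nonneg.2 huv) hu₀.1.le
    simpa using this
  have hlarge : ∀ (q : ℝ → Prop) (c : ℝ), (∀ᵐ v : ℝ, q v) → ∃ v, c < v ∧ q v := by
    intro q c hq
    obtain ⟨v, hv, hqv⟩ := Measure.exists_mem_of_measure_ne_zero_of_ae
      (s := Ioi c) (μ := volume) (by simp) (ae_restrict_of_ae hq)
    exact ⟨v, hv, hqv⟩
  have hIII : ∀ᵐ x ∂lebesgueIco, ∀ᵐ u : ℝ, 0 ≤ u → ψ (x, u) = h x := by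
    filter_upwards [hI, hII] with x h1 h2
    filter_upwards [h1] with u h3 hu
    have h4 : ∀ᵐ t : ℝ, u₀ ≤ u + t → ψ (x, u + t) = h x :=
      (measurePreserving_add_left volume u).quasiMeasurePreserving.ae h2
    obtain ⟨t, ht, h5, h6⟩ := hlarge _ u₀ (h3.and h4)
    rw [← h5 (hu₀.1.le.trans ht.le) hu, h6 (by linarith)]
  refine ⟨h, hψm.comp (measurable_id.prodMk measurable_const), ?_, ?_⟩
  · filter_upwards [hIII, hT.measurePreserving.quasiMeasurePreserving.ae hIII, hreg]
      with x h1 h2 hx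
    have hfx : 0 ≤ f x := by simpa using hx.1 0
    have h3 : ∀ᵐ v : ℝ, 0 ≤ v - f x → ψ (T x, v - f x) = h (T x) :=
      (measurePreserving_sub_right volume (f x)).quasiMeasurePreserving.ae h2
    obtain ⟨v, hv, h4, h5⟩ := hlarge _ (f x) (h1.and h3)
    have h4 := h4 (hfx.trans hv.le)
    have h5 := h5 (by linarith)
    rw [← h4, ← h5]
    -- Unrolling from $(Tx,v-f(x))$ and from $(x,v)$ leads to the same point of the phase space,
    -- with indices $n$ and $n+1$.
    have hGG : G (T x, v - f x) = G (x, v) := by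
      obtain ⟨n, hn1, hn2⟩ := hx.image.exists_index (u := v - f x) (by linarith)
      have hs : ∀ k : ℤ, cocycleSum T f (k + 1) x = f x + cocycleSum T f k (T x) := by
        intro k
        have e1 := cocycleSum_add T f 1 k x
        have e2 := cocycleSum_add_one T f 0 x
        simp only [cocycleSum_zero, zero_add, zpow_zero, Equiv.Perm.one_apply, zpow_one] at e1 e2
        rw [add_comm, e1, e2]
      have e : skewPow T f n (T x, v - f x) = skewPow T f (n + 1 : ℕ) (x, v) := by
        simp only [skewPow, Nat.cast_add, Nat.cast_one, hs]
        rw [zpow_add_one, Equiv.Perm.mul_apply, sub_sub]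
      rw [hG (T x) hx.image _ n hn1 hn2 ⟨_, RegularPoint.skewPow_mem hn1 hn2⟩ rfl]
      refine (hG x hx v (n + 1) ?_ ?_ _ e).symm
      · push_cast
        rw [hs]; linarith
      · push_cast
        rw [hs]; linarith
    simp only [hψ]
    rw [hGG, ← mul_assoc, ← Complex.exp_add]
    congr 2
    push_cast
    ring
  · have hprod : ∀ᵐ p ∂lebesgueIco.prod (volume : Measure ℝ), 0 ≤ p.2 → ψ p = h p.1 := by
      rw [Measure.ae_prod_iff_ae_ae]
      · exact hIII
      · have : {p : UnitIco × ℝ | 0 ≤ p.2 → ψ p = h p.1} =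
            {p | 0 ≤ p.2}ᶜ ∪ {p | ψ p = h p.1} := by
          ext q
          simp only [mem_ofPred_eq, mem_union, mem_compl_iff]
          tauto
        rw [this]
        exact (measurableSet_le measurable_const measurable_snd).compl.union
          (measurableSet_eq_fun hψm (hψm.comp (measurable_fst.prodMk measurable_const)))
    filter_upwards [hprod, Measure.quasiMeasurePreserving_fst.ae hreg] with p hp hx z hz
    have hz0 := z.2
    rw [hz] at hz0
    have e := hG p.1 hx p.2 0 (by simpa [cocycleSum_zero] using hz0.1)
      (by
        rw [cocycleSum_add_one]
        simpa [cocycleSum_zero] using hz0.2) z (by rw [hz]; simp [skewPow, cocycleSum_zero])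
    rw [← e, hGψ, hp hz0.1]

/-! ### From ergodicity to weak mixing -/

theorem isWeaklyMixingFlow_of_ergodic {T : Equiv.Perm UnitIco} (hT : IsIET T)
    (hE : Ergodic T lebesgueIco) {f : ℝ → ℝ} {A : Set ℝ} (hAfin : A.Finite)
    (hf_nonneg : ∀ x ∈ Set.Ico (0 : ℝ) 1 \ A, 0 ≤ f x)
    (hf_ne : ∃ x ∈ Set.Ioo (0 : ℝ) 1 \ A, f x ≠ 0)
    (hf_C2 : ContDiffOn ℝ 2 f (Set.Ioo (0 : ℝ) 1 \ A))
    (hdisc : ∀ x : UnitIco, ¬ ContinuousAt T x → (x : ℝ) ∈ A) (hgrowth : AtLeastLogGrowth f A) :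
    IsWeaklyMixingFlow (specialFlow T f) (specialFlowMeasure f) := by
  have hcont := hf_C2.continuousOn
  have hf := measurable_roof hAfin hcont
  intro s g hg heig
  set θ : ℝ := 2 * Real.pi * s with hθ
  obtain ⟨h, hm, hrel, hgh⟩ := exists_base_function hT hf
    (ae_cocycleSum_unbounded hT hE hAfin hf_nonneg hf_ne hcont) hg (θ := θ) (by
      intro t
      filter_upwards [heig t] with z hz
      rw [hz]
      congr 2
      rw [hθ]
      push_cast
      ring)
  have hconst : ∀ c : ℂ, (∀ᵐ x ∂lebesgueIco, h x = c) → (θ = 0 ∨ c = 0) →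
      ∀ᵐ z ∂specialFlowMeasure f, g z = c := by
    intro c hc h0
    rw [ae_iff, specialFlowMeasure_apply hf]
    refine measure_mono_null ?_ (ae_iff.1 (hgh.and (Measure.quasiMeasurePreserving_fst.ae hc)))
    rintro _ ⟨z, hz, rfl⟩ ⟨h1, h2⟩
    apply hz
    rw [h1 z rfl, h2]
    rcases h0 with h0 | h0 <;> simp [h0]
  have hnorm : ∃ c : ℝ, ∀ᵐ x ∂lebesgueIco, ‖h x‖ = c := by
    refine hE.ae_eq_const_of_ae_eq_comp_ae hm.norm.aestronglyMeasurable ?_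
    filter_upwards [hrel] with x hx
    have : Complex.I * θ * f x = ((θ * f x : ℝ) : ℂ) * Complex.I := by push_cast; ring
    rw [Function.comp_apply, hx, norm_mul, this, Complex.norm_exp_ofReal_mul_I, one_mul]
  obtain ⟨c, hc⟩ := hnorm
  by_cases hc0 : c = 0
  · refine ⟨0, hconst 0 ?_ (Or.inr rfl)⟩
    filter_upwards [hc] with x hx
    rwa [hc0, norm_eq_zero] at hx
  by_cases hθ0 : θ = 0
  · obtain ⟨d, hd⟩ := hE.ae_eq_const_of_ae_eq_comp_ae hm.aestronglyMeasurable (by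
      filter_upwards [hrel] with x hx
      rw [Function.comp_apply, hx, hθ0]
      simp)
    exact ⟨d, hconst d hd (Or.inl hθ0)⟩
  exfalso
  obtain ⟨s₀, hs₀⟩ := no_transfer_function hT hE hAfin hf_C2 hdisc hgrowth
  obtain ⟨k, hk⟩ := exists_nat_gt (s₀ / |θ|)
  rw [div_lt_iff₀ (abs_pos.2 hθ0)] at hk
  classical
  -- The value $1$ at zeros of $h$ makes $h_1$ unimodular everywhere. Off a null set it is $h/c$, so
  -- $h_1^k$ solves the equation for $k\theta$.
  set h₁ : UnitIco → ℂ := fun x => if h x = 0 then 1 else h x / ‖h x‖ with hh₁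
  have hh₁m : Measurable h₁ := Measurable.ite (hm (measurableSet_singleton 0)) measurable_const
    (hm.div (Complex.measurable_ofReal.comp hm.norm))
  have hh₁n : ∀ x, ‖h₁ x‖ = 1 := by
    intro x
    simp only [hh₁]
    split_ifs with h0
    · simp
    · rw [norm_div, Complex.norm_real, norm_norm, div_self (norm_ne_zero_iff.2 h0)]
  refine hs₀ (k * θ) (by rw [abs_mul, Nat.abs_cast]; exact hk.le) (fun x => h₁ x ^ k)
    (hh₁m.pow_const k) (fun x => by rw [norm_pow, hh₁n, one_pow]) ?_
  filter_upwards [hrel, hc, hT.measurePreserving.quasiMeasurePreserving.ae hc] with x h1 h2 h3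
  have hne : ∀ y, ‖h y‖ = c → h₁ y = h y / c := by
    intro y hy
    have : h y ≠ 0 := by
      rw [← norm_ne_zero_iff, hy]; exact hc0
    simp only [hh₁, if_neg this, hy]
  rw [hne x h2, hne (T x) h3, h1, mul_div_assoc, mul_pow, ← Complex.exp_nat_mul]
  congr 2
  push_cast
  ring

/-! ### From weak mixing to ergodicity -/

theorem zpow_mem_iff {T : Equiv.Perm UnitIco} {E : Set UnitIco} (hE : T ⁻¹' E = E) (n : ℤ)
    (x : UnitIco) : (T ^ n) x ∈ E ↔ x ∈ E := by
  have h : ∀ x, T x ∈ E ↔ x ∈ E := fun x => by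
    conv_rhs => rw [← hE]
    rfl
  induction n using Int.induction_on with
  | zero => simp
  | succ n ih =>
    rw [add_comm, zpow_one_add, Equiv.Perm.mul_apply]
    exact (h _).trans ih
  | pred n ih =>
    refine Iff.trans ?_ ih
    rw [← h ((T ^ (-(n : ℤ) - 1)) x), ← Equiv.Perm.mul_apply, ← zpow_one_add, add_sub_cancel]

theorem ae_base_of_ae_specialFlowMeasure {f : ℝ → ℝ} (hf : Measurable fun x : UnitIco => f x)
    {Q : UnitIco → Prop} (h : ∀ᵐ z ∂specialFlowMeasure f, Q z.1.1) :
    ∀ᵐ x : UnitIco ∂lebesgueIco, 0 < f x → Q x := by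
  rw [ae_iff, specialFlowMeasure_apply hf] at h
  filter_upwards [Measure.measure_ae_null_of_prod_null h] with x hx hfx
  by_contra hQ
  have hsub : Ico 0 (f x) ⊆ Prod.mk x ⁻¹' (Subtype.val '' {z : SpecialFlowSpace f | ¬ Q z.1.1}) :=
    fun u hu => ⟨⟨(x, u), hu⟩, hQ, rfl⟩
  have h0 := measure_mono_null hsub hx
  rw [Real.volume_Ico] at h0
  simp at h0
  linarith

/-- Under weak mixing of the flow, an invariant set of the base is trivial relative to the support
of the roof. -/
theorem IsWeaklyMixingFlow.invariant_set {T : Equiv.Perm UnitIco} {f : ℝ → ℝ}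
    (hf : Measurable fun x : UnitIco => f x)
    (hwm : IsWeaklyMixingFlow (specialFlow T f) (specialFlowMeasure f)) {E : Set UnitIco}
    (hEm : MeasurableSet E) (hE : T ⁻¹' E = E) :
    lebesgueIco (E ∩ {x | 0 < f x}) = 0 ∨ lebesgueIco (Eᶜ ∩ {x | 0 < f x}) = 0 := by
  classical
  have hfst : Measurable fun z : SpecialFlowSpace f => z.1.1 :=
    measurable_fst.comp measurable_subtype_coe
  obtain ⟨c, hc⟩ := hwm 0 (fun z => if z.1.1 ∈ E then 1 else 0)
    (Measurable.ite (hfst hEm) measurable_const measurable_const) (by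
      intro t
      refine Eventually.of_forall fun z => ?_
      have : (specialFlow T f t z).1.1 ∈ E ↔ z.1.1 ∈ E := by
        unfold specialFlow
        split_ifs with h
        · exact zpow_mem_iff hE _ _
        · rfl
      simp [this])
  by_cases hc1 : c = 1
  · right
    have h1 : ∀ᵐ z ∂specialFlowMeasure f, z.1.1 ∈ E := by
      filter_upwards [hc] with z hz
      by_contra hzE
      simp [hzE, hc1] at hz
    have h2 := ae_base_of_ae_specialFlowMeasure hf (Q := fun x => x ∈ E) h1
    refine measure_mono_null ?_ (ae_iff.1 h2)
    rintro x ⟨hx1, hx2⟩ hx3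
    exact hx1 (hx3 hx2)
  · left
    have h1 : ∀ᵐ z ∂specialFlowMeasure f, z.1.1 ∉ E := by
      filter_upwards [hc] with z hz hzE
      simp only [hzE, if_true] at hz
      exact hc1 hz.symm
    have h2 := ae_base_of_ae_specialFlowMeasure hf (Q := fun x => x ∉ E) h1
    refine measure_mono_null ?_ (ae_iff.1 h2)
    rintro x ⟨hx1, hx2⟩ hx3
    exact hx3 hx2 hx1

theorem exists_pos_near_singularities {f : ℝ → ℝ} {A : Set ℝ} (hAfin : A.Finite)
    (hf_left : ∀ a ∈ A, Filter.Tendsto f (nhdsWithin a (Set.Iio a)) Filter.atTop)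
    (hf_right : ∀ a ∈ A, Filter.Tendsto f (nhdsWithin a (Set.Ioi a)) Filter.atTop) :
    ∃ δ > 0, ∀ a ∈ A, ∀ x : ℝ, x ≠ a → |x - a| < δ → 0 < f x := by
  have h : ∀ a ∈ A, ∀ᶠ δ : ℝ in 𝓝[>] 0, ∀ x : ℝ, x ≠ a → |x - a| < δ → 0 < f x := by
    intro a ha
    have h1 : ∀ᶠ x in 𝓝[≠] a, 0 < f x := by
      rw [← Iio_union_Ioi, nhdsWithin_union]
      exact eventually_sup.2
        ⟨(hf_left a ha).eventually_gt_atTop 0, (hf_right a ha).eventually_gt_atTop 0⟩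
    rw [eventually_nhdsWithin_iff, Metric.eventually_nhds_iff] at h1
    obtain ⟨ε, hε, hball⟩ := h1
    filter_upwards [Ioc_mem_nhdsGT hε] with δ hδ x hx hxδ
    exact hball (hxδ.trans_le hδ.2) hx
  obtain ⟨δ, h1, h2⟩ := (((eventually_all_finite hAfin).2 h).and self_mem_nhdsWithin).exists
  exact ⟨δ, h2, h1⟩

theorem lebesgueIco_pos_of_isOpen {W : Set UnitIco} (hW : IsOpen W) (hne : W.Nonempty) :
    lebesgueIco W ≠ 0 := by
  obtain ⟨o, ho⟩ := hne
  obtain ⟨ε, hε, hball⟩ := Metric.isOpen_iff.1 hW o ho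
  have ho1 : (o : ℝ) < 1 := o.2.2
  have hsub : {z : UnitIco | (o : ℝ) ≤ z ∧ (z : ℝ) < min (o + ε) 1} ⊆ W := by
    rintro z ⟨hz1, hz2⟩
    apply hball
    rw [Metric.mem_ball, Subtype.dist_eq, Real.dist_eq, abs_of_nonneg (by linarith)]
    linarith [hz2.trans_le (min_le_left _ _)]
  refine (lt_of_lt_of_le ?_ (measure_mono hsub)).ne'
  rw [lebesgueIco_between o.2.1 (min_le_right _ _)]
  simp [hε, ho1]

theorem exists_small_subset {D : Set UnitIco} (hDm : MeasurableSet D) (hD : lebesgueIco D ≠ 0)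
    {ε : ℝ} (hε : 0 < ε) :
    ∃ S ⊆ D, MeasurableSet S ∧ lebesgueIco S ≠ 0 ∧ lebesgueIco S ≤ ENNReal.ofReal ε := by
  by_contra! hcon
  apply hD
  have hcover : D ⊆ ⋃ j : ℕ, D ∩ {z : UnitIco | |(z : ℝ) - j * (ε / 2)| ≤ ε / 2} := by
    intro z hz
    refine mem_iUnion.2 ⟨⌊(z : ℝ) / (ε / 2)⌋₊, hz, ?_⟩
    have h1 := Nat.floor_le (div_nonneg z.2.1 (by linarith : (0 : ℝ) ≤ ε / 2))
    have h2 := Nat.lt_floor_add_one ((z : ℝ) / (ε / 2))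
    rw [le_div_iff₀ (by linarith)] at h1
    rw [div_lt_iff₀ (by linarith)] at h2
    change |(z : ℝ) - (⌊(z : ℝ) / (ε / 2)⌋₊ : ℝ) * (ε / 2)| ≤ ε / 2
    rw [abs_le]
    constructor <;> linarith
  refine measure_mono_null hcover (measure_iUnion_null fun j => ?_)
  by_contra h0
  refine absurd (hcon _ inter_subset_left (hDm.inter ?_) h0) (not_lt.2 ?_)
  · exact measurableSet_le (measurable_subtype_coe.sub_const _).norm measurable_const
  · refine (measure_mono inter_subset_right).trans ((lebesgueIco_abs_sub_le _ _).trans ?_)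
    rw [mul_div_cancel₀ _ two_ne_zero]

/-- Pigeonhole gives $T^py=y+\tau$ with $|\tau|<\delta$ on the orbit. The translation property
reproduces this step at each $T^{pn}y$, so $T^{pn}y=y+n\tau$, which stays in $[0,1)$ only if
$\tau=0$. -/
theorem IsIET.exists_period {T : Equiv.Perm UnitIco} {δ : ℝ} (hδ : 0 < δ)
    {x : UnitIco} (h : ∀ (i k : ℕ) (z : UnitIco), |(z : ℝ) - (T^[i] x : UnitIco)| < δ →
      ((T^[k] z : UnitIco) : ℝ) = z + ((T^[k] (T^[i] x) : UnitIco) - (T^[i] x : UnitIco))) :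
    ∃ p : ℕ, 1 ≤ p ∧ ∀ z : UnitIco, |(z : ℝ) - x| < δ → T^[p] z = z := by
  obtain ⟨N, hN⟩ := exists_nat_gt (1 / δ)
  have hN0 : (0 : ℝ) < N := lt_trans (by positivity) hN
  obtain ⟨i, j, hij, -, hclose⟩ := exists_close_pair (fun i => T^[i] x) (N := N)
    (by exact_mod_cast hN0)
  have hNδ : 1 / (N : ℝ) < δ := by rwa [div_lt_comm₀ hN0 hδ]
  set p := j - i with hp
  set y := T^[i] x with hy
  set τ : ℝ := ((T^[p] y : UnitIco) : ℝ) - y with hτ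
  have hτδ : |τ| < δ := by
    rw [hτ, hy, ← Function.iterate_add_apply, hp, Nat.sub_add_cancel hij.le]
    exact hclose.trans hNδ
  have hstep : ∀ n : ℕ, ((T^[p * (n + 1)] y : UnitIco) : ℝ) = (T^[p * n] y : UnitIco) + τ := by
    intro n
    induction n with
    | zero => simp [hτ]
    | succ n ih =>
      have e := h (p * n + i) p (T^[p * (n + 1)] y) (by
        rw [Function.iterate_add_apply, ih, add_sub_cancel_left]; exact hτδ)
      have e0 : T^[p * n + i] x = T^[p * n] y := Function.iterate_add_apply ..
      have e1 : T^[p] (T^[p * n] y) = T^[p * (n + 1)] y := by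
        rw [← Function.iterate_add_apply, show p + p * n = p * (n + 1) by ring]
      rw [show p * (n + 1 + 1) = p + p * (n + 1) by ring, Function.iterate_add_apply, e, e0, e1, ih]
      ring
  have hlin : ∀ n : ℕ, ((T^[p * n] y : UnitIco) : ℝ) = y + n * τ := by
    intro n
    induction n with
    | zero => simp
    | succ n ih => rw [hstep, ih]; push_cast; ring
  have hτ0 : τ = 0 := by
    by_contra hne
    obtain ⟨n, hn⟩ := exists_nat_gt (1 / |τ|)
    rw [div_lt_iff₀ (abs_pos.2 hne)] at hn
    have e := hlin n
    have h1 : |(n : ℝ) * τ| < 1 := by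
      rw [show (n : ℝ) * τ = (T^[p * n] y : UnitIco) - y by linarith, abs_lt]
      have h2 := (T^[p * n] y).2
      have h3 := y.2
      constructor <;> linarith [h2.1, h2.2, h3.1, h3.2]
    rw [abs_mul, Nat.abs_cast] at h1
    linarith
  have hper : T^[p] x = x := by
    apply T.injective.iterate i
    rw [← Function.iterate_add_apply, add_comm, Function.iterate_add_apply, ← hy]
    exact Subtype.ext (sub_eq_zero.1 hτ0)
  refine ⟨p, by lia, fun z hz => Subtype.ext ?_⟩
  have e := h 0 p z hz
  simp only [Function.iterate_zero, id, hper, sub_self, add_zero] at e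
  exact e

/-- If the flow is weakly mixing, almost every orbit of the base meets the support of the roof. -/
theorem IsWeaklyMixingFlow.ae_orbit_meets_support {T : Equiv.Perm UnitIco} (hT : IsIET T)
    {f : ℝ → ℝ} {A : Set ℝ} (hAfin : A.Finite)
    (hf_nonneg : ∀ x ∈ Set.Ico (0 : ℝ) 1 \ A, 0 ≤ f x)
    (hf_ne : ∃ x ∈ Set.Ioo (0 : ℝ) 1 \ A, f x ≠ 0)
    (hcont : ContinuousOn f (Set.Ioo (0 : ℝ) 1 \ A))
    (hf_left : ∀ a ∈ A, Filter.Tendsto f (nhdsWithin a (Set.Iio a)) Filter.atTop)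
    (hf_right : ∀ a ∈ A, Filter.Tendsto f (nhdsWithin a (Set.Ioi a)) Filter.atTop)
    (hdisc : ∀ x : UnitIco, ¬ ContinuousAt T x → (x : ℝ) ∈ A)
    (hwm : IsWeaklyMixingFlow (specialFlow T f) (specialFlowMeasure f)) :
    ∀ᵐ x ∂lebesgueIco, ∃ n : ℤ, 0 < f ((T ^ n) x) := by
  have hf := measurable_roof hAfin hcont
  set P : Set UnitIco := {x | 0 < f x} with hP
  have hPm : MeasurableSet P := measurableSet_lt measurable_const hf
  have hP0 : lebesgueIco P ≠ 0 := by
    obtain ⟨δ, hδ, h⟩ := exists_positive_level hAfin hf_nonneg hf_ne hcont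
    exact fun h0 => h (measure_mono_null (fun x hx => hδ.trans hx) h0)
  obtain ⟨δ, hδ, hnear⟩ := exists_pos_near_singularities hAfin hf_left hf_right
  set Q : Set UnitIco := {x | ∃ n : ℤ, (T ^ n) x ∈ P} with hQ
  set Z : Set UnitIco := {x | ∀ n : ℤ, (T ^ n) x ∉ P ∧ (((T ^ n) x : UnitIco) : ℝ) ∉ A} with hZ
  have hQZ : ∀ᵐ x ∂lebesgueIco, x ∈ Q ∪ Z := by
    filter_upwards [hT.ae_orbit_avoids hAfin] with x hx
    by_cases h : x ∈ Q
    · exact Or.inl h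
    · exact Or.inr fun n => ⟨fun hn => h ⟨n, hn⟩, hx n⟩
  by_contra hcon
  have hZne : Z.Nonempty := by
    by_contra hempty
    rw [not_nonempty_iff_eq_empty] at hempty
    rw [hempty, union_empty] at hQZ
    exact hcon hQZ
  -- Since $f>0$ within $\delta$ of $A$ off $A$, an orbit in $Z$ keeps distance at least $\delta$
  -- from every singularity.
  have htrans : ∀ x ∈ Z, ∀ (i k : ℕ) (z : UnitIco), |(z : ℝ) - (T^[i] x : UnitIco)| < δ →
      ((T^[k] z : UnitIco) : ℝ) = z + ((T^[k] (T^[i] x) : UnitIco) - (T^[i] x : UnitIco)) := by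
    intro x hx i k z hz
    refine hT.translation_on_ball hdisc hδ (N := k) ?_ le_rfl hz
    intro l _ a ha
    rw [← Function.iterate_add_apply, Equiv.Perm.iterate_eq_pow, ← zpow_natCast]
    obtain ⟨h1, h2⟩ := hx ((l + i : ℕ) : ℤ)
    by_contra! hlt
    exact h1 (hnear a ha _ (fun h => h2 (h ▸ ha)) hlt)
  have hball : ∃ x ∈ Z, lebesgueIco (Metric.ball x δ ∩ Q) ≠ 0 := by
    by_contra! hnull
    set O : Set UnitIco := ⋃ x ∈ Z, Metric.ball x δ with hO
    have hOo : IsOpen O := isOpen_biUnion fun _ _ => Metric.isOpen_ball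
    have hOc : IsClosed O := by
      -- A closure point $y$ is near some $o$ in a ball about $x\in Z$. Almost every point of that
      -- ball lies in $Z$, so a centre in $Z$ can be chosen within $\delta/2$ of $o$, and its ball
      -- contains $y$.
      refine isClosed_of_closure_subset fun y hy => ?_
      obtain ⟨o, ho, hyo⟩ := Metric.mem_closure_iff.1 hy (δ / 2) (by linarith)
      simp only [hO, mem_iUnion, exists_prop] at ho
      obtain ⟨x, hx, hox⟩ := ho
      have hW0 := lebesgueIco_pos_of_isOpen (W := Metric.ball o (δ / 2) ∩ Metric.ball x δ)
        (Metric.isOpen_ball.inter Metric.isOpen_ball)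
        ⟨o, Metric.mem_ball_self (by linarith), hox⟩
      obtain ⟨x', hx', hxZ⟩ : ∃ x' ∈ Metric.ball o (δ / 2) ∩ Metric.ball x δ, x' ∈ Z := by
        by_contra! hno
        refine hW0 (measure_mono_null (t := (Metric.ball x δ ∩ Q) ∪ (Q ∪ Z)ᶜ) ?_
          (measure_union_null (hnull x hx) hQZ))
        intro w hw
        by_cases hwQ : w ∈ Q
        · exact Or.inl ⟨hw.2, hwQ⟩
        · exact Or.inr fun h => h.elim hwQ (hno w hw)
      refine mem_biUnion hxZ ?_
      rw [Metric.mem_ball]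
      have := hx'.1
      rw [Metric.mem_ball, dist_comm] at this
      linarith [dist_triangle y o x']
    have hpre : PreconnectedSpace UnitIco :=
      isPreconnected_iff_preconnectedSpace.1 isPreconnected_Ico
    have hOu : O = univ := by
      obtain ⟨x, hx⟩ := hZne
      exact IsClopen.eq_univ ⟨hOc, hOo⟩ ⟨x, mem_biUnion hx (Metric.mem_ball_self hδ)⟩
    have hQ0 : lebesgueIco Q = 0 := by
      refine measure_null_of_locally_null Q fun y _ => ?_
      have : y ∈ O := hOu ▸ mem_univ y
      simp only [hO, mem_iUnion, exists_prop] at this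
      obtain ⟨x, hx, hyx⟩ := this
      exact ⟨Metric.ball x δ ∩ Q, inter_mem (mem_nhdsWithin_of_mem_nhds (Metric.isOpen_ball.mem_nhds hyx))
        self_mem_nhdsWithin, hnull x hx⟩
    exact hP0 (measure_mono_null (show P ⊆ Q from fun x hx => ⟨0, hx⟩) hQ0)
  obtain ⟨x, hxZ, hxQ⟩ := hball
  obtain ⟨p, hp1, hper⟩ := IsIET.exists_period hδ (htrans x hxZ)
  obtain ⟨n, hn⟩ : ∃ n : ℤ, lebesgueIco (Metric.ball x δ ∩ (T ^ n) ⁻¹' P) ≠ 0 := by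
    by_contra! hall
    refine hxQ (measure_mono_null ?_ (measure_iUnion_null hall))
    rintro w ⟨hw, m, hm⟩
    exact mem_iUnion.2 ⟨m, hw, hm⟩
  have hPpos : 0 < (lebesgueIco P).toReal := ENNReal.toReal_pos hP0 (measure_ne_top _ _)
  have hp0 : (0 : ℝ) < p := by exact_mod_cast hp1
  -- The union of $p$ preimages of $S$ is invariant because $T^p$ fixes $S$ pointwise. Its measure
  -- is at most $\mu(P)/2$, so it cannot contain almost all of $P$, while $T^nS\subseteq P$ prevents
  -- it from being null on $P$.
  obtain ⟨S, hSD, hSm, hS0, hSle⟩ := exists_small_subset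
    (Metric.isOpen_ball.measurableSet.inter ((hT.measurePreserving_zpow n).measurable hPm)) hn
    (ε := (lebesgueIco P).toReal / (2 * p)) (by positivity)
  have hSper : ∀ w ∈ S, T^[p] w = w := fun w hw => hper w (hSD hw).1
  set E : Set UnitIco := ⋃ i ∈ Finset.range p, T^[i] ⁻¹' S with hEdef
  have hEmem : ∀ w, w ∈ E ↔ ∃ i < p, T^[i] w ∈ S := by
    intro w
    simp only [hEdef, mem_iUnion, Finset.mem_range, exists_prop, mem_preimage]
  have hEm : MeasurableSet E := Finset.measurableSet_biUnion _ fun i _ =>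
    (hT.measurable.iterate i) hSm
  have hEinv : T ⁻¹' E = E := by
    ext w
    rw [mem_preimage, hEmem, hEmem]
    constructor
    · rintro ⟨i, hi, hw⟩
      rw [← Function.iterate_succ_apply] at hw
      rcases (show i + 1 ≤ p from hi).lt_or_eq with h | h
      · exact ⟨i + 1, h, hw⟩
      · rw [Nat.succ_eq_add_one, h] at hw
        have : T^[p] w = w := T.injective.iterate p (hSper _ hw)
        exact ⟨0, by lia, this ▸ hw⟩
    · rintro ⟨i, hi, hw⟩
      rcases i with _ | i
      · refine ⟨p - 1, by lia, ?_⟩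
        rw [← Function.iterate_succ_apply, Nat.succ_eq_add_one, Nat.sub_add_cancel hp1]
        have hw' : w ∈ S := hw
        rwa [hSper w hw']
      · exact ⟨i, by lia, by rwa [← Function.iterate_succ_apply]⟩
  have hEle : lebesgueIco E < lebesgueIco P := by
    calc lebesgueIco E ≤ ∑ i ∈ Finset.range p, lebesgueIco (T^[i] ⁻¹' S) :=
          measure_biUnion_finset_le _ _
      _ ≤ ∑ i ∈ Finset.range p, ENNReal.ofReal ((lebesgueIco P).toReal / (2 * p)) :=
          Finset.sum_le_sum fun i _ =>
            ((hT.measurePreserving.iterate i).measure_preimage_le S).trans hSle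
      _ = ENNReal.ofReal ((lebesgueIco P).toReal / 2) := by
          rw [Finset.sum_const, Finset.card_range, ← ENNReal.ofReal_nsmul]
          congr 1
          rw [nsmul_eq_mul]
          field_simp
      _ < ENNReal.ofReal (lebesgueIco P).toReal :=
          (ENNReal.ofReal_lt_ofReal_iff hPpos).2 (by linarith)
      _ = lebesgueIco P := ENNReal.ofReal_toReal (measure_ne_top _ _)
  rcases hwm.invariant_set hf hEm hEinv with h | h
  · refine hS0 (measure_mono_null (t := (T ^ n) ⁻¹' (E ∩ P)) ?_
      ((hT.measurePreserving_zpow n).quasiMeasurePreserving.preimage_null h))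
    intro w hw
    exact ⟨(zpow_mem_iff hEinv n w).2 ((hEmem w).2 ⟨0, by lia, hw⟩), (hSD hw).2⟩
  · refine absurd hEle (not_lt.2 ?_)
    calc lebesgueIco P ≤ lebesgueIco (E ∪ Eᶜ ∩ P) := measure_mono fun w hw => by
          by_cases hwE : w ∈ E
          · exact Or.inl hwE
          · exact Or.inr ⟨hwE, hw⟩
      _ ≤ lebesgueIco E + lebesgueIco (Eᶜ ∩ P) := measure_union_le _ _
      _ = lebesgueIco E := by rw [h, add_zero]

theorem mainTheorem2
    (T : Equiv.Perm UnitIco) (hT : IsIET T)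
    (f : ℝ → ℝ) (A : Set ℝ) (hAfin : A.Finite) (hA : A ⊆ Set.Ioo (0 : ℝ) 1)
    (hf_nonneg : ∀ x ∈ Set.Ico (0 : ℝ) 1 \ A, 0 ≤ f x)
    (hf_ne : ∃ x ∈ Set.Ioo (0 : ℝ) 1 \ A, f x ≠ 0)
    (hf_C2 : ContDiffOn ℝ 2 f (Set.Ioo (0 : ℝ) 1 \ A))
    (hf_left : ∀ a ∈ A, Filter.Tendsto f (nhdsWithin a (Set.Iio a)) Filter.atTop)
    (hf_right : ∀ a ∈ A, Filter.Tendsto f (nhdsWithin a (Set.Ioi a)) Filter.atTop)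
    (hdisc : ∀ x : UnitIco, ¬ ContinuousAt T x → (x : ℝ) ∈ A)
    (hgrowth : AtLeastLogGrowth f A) :
    IsWeaklyMixingFlow (specialFlow T f) (specialFlowMeasure f) ↔ Ergodic T lebesgueIco := by
  refine ⟨fun hwm => ⟨hT.measurePreserving, ⟨fun E hEm hE => ?_⟩⟩, fun hE =>
    isWeaklyMixingFlow_of_ergodic hT hE hAfin hf_nonneg hf_ne hf_C2 hdisc hgrowth⟩
  have hmeets := hwm.ae_orbit_meets_support hT hAfin hf_nonneg hf_ne hf_C2.continuousOn hf_left
    hf_right hdisc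
  -- An invariant set that is null on the support of $f$ is null, since almost every one of its
  -- points is carried into that support by some iterate.
  have key : ∀ F : Set UnitIco, T ⁻¹' F = F → lebesgueIco (F ∩ {x | 0 < f x}) = 0 →
      lebesgueIco F = 0 := by
    intro F hF h0
    have h1 : ∀ᵐ x ∂lebesgueIco, ∀ n : ℤ, (T ^ n) x ∉ F ∩ {x : UnitIco | 0 < f x} :=
      ae_all_iff.2 fun n => (hT.measurePreserving_zpow n).quasiMeasurePreserving.ae
        (measure_eq_zero_iff_ae_notMem.1 h0)
    rw [measure_eq_zero_iff_ae_notMem]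
    filter_upwards [h1, hmeets] with x hx ⟨n, hn⟩ hxF
    exact hx n ⟨(zpow_mem_iff hF n x).2 hxF, hn⟩
  rw [eventuallyConst_set']
  rcases hwm.invariant_set (measurable_roof hAfin hf_C2.continuousOn) hEm hE with h | h
  · exact Or.inl (ae_eq_empty.2 (key E hE h))
  · exact Or.inr (ae_eq_univ.2 (key Eᶜ (by rw [preimage_compl, hE]) h))
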